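/- **Theorem 3.1** (weak Harnack inequality). Let $N\ge 2$ be an integer, $s\in(0,1)$ and $p\in(1,\infty)$. There are constants $\sigma\in(0,1)$ and $C>0$, depending only on $N,s,p$, with the following property. Let $R>0$, $K\ge 0$, and let $u\in\widetilde W^{s,p}(B_{R/3})$ satisfy $$(-\Delta)_p^s u\ge -K\ \text{ weakly in } B_{R/3},\qquad u\ge 0\ \text{ a.e. in }\mathbb R^N .$$ Then $$\operatorname*{ess\,inf}_{B_{R/4}}u\;\ge\;\sigma\Big(\frac1{|B_R\setminus B_{R/2}|}\int_{B_R\setminus B_{R/2}}u^{p-1}\,dx\Big)^{\frac1{p-1}}-C\,(KR^{ps})^{\frac1{p-1}} .$$ Here $B_r$ is the open ball of radius $r$ centered at $0$ in $\mathbb R^N$, and $|A|$ is the Lebesgue measure of $A$. For open $U\subseteq\mathbb R^N$, $W^{s,p}(U)$ is the space of $u\in L^p(U)$ with $\int_{U\times U}\frac{|u(x)-u(y)|^p}{|x-y|^{N+ps}}\,dx\,dy<\infty$, and $W^{s,p}_0(U)$ is the space of $u\in W^{s,p}(\mathbb R^N)$ with $u=0$ a.e. in $\mathbb R^N\setminus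 U$. For bounded open $U$, $\widetilde W^{s,p}(U)$ is the space of $u\in L^p_{\rm loc}(\mathbb R^N)$ such that $u\in W^{s,p}(V)$ for some open $V\supset\overline U$ and $\int_{\mathbb R^N}\frac{|u(x)|^{p-1}}{(1+|x|)^{N+ps}}\,dx<\infty$. Finally, $(-\Delta)_p^su\ge -K$ weakly in $U$ means that $u\in\widetilde W^{s,p}(U)$ and, for all $\varphi\in W^{s,p}_0(U)$ with $\varphi\ge0$ a.e., $$\int_{\mathbb R^N\times\mathbb R^N}\frac{|u(x)-u(y)|^{p-2}(u(x)-u(y))\,(\varphi(x)-\varphi(y))}{|x-y|^{N+ps}}\,dx\,dy\;\ge\;-K\int_U\varphi\,dx .$$ -/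

import Mathlib

open MeasureTheory Set

namespace FracPLap

/-- The Euclidean space `ℝ^N`. -/
abbrev Space (N : ℕ) : Type := EuclideanSpace ℝ (Fin N)

/-- The odd power `a^q = |a|^{q-1} a`, for real `a`. -/
noncomputable def oddPow (a q : ℝ) : ℝ := |a| ^ (q - 1) * a

/-- The `p`-th power of the Gagliardo seminorm of `u` on `U`, with values in `[0, ∞]`. -/
noncomputable def gagliardoPow {N : ℕ} (s p : ℝ) (U : Set (Space N)) (u : Space N → ℝ) :
    ENNReal :=
  ∫⁻ z in U ×ˢ U, ENNReal.ofReal (|u z.1 - u z.2| ^ p / ‖z.1 - z.2‖ ^ ((N : ℝ) + p * s))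

/-- `u ∈ W^{s,p}(U)` (only the values of `u` on `U` matter). -/
def MemW {N : ℕ} (s p : ℝ) (U : Set (Space N)) (u : Space N → ℝ) : Prop :=
  MemLp u (ENNReal.ofReal p) (volume.restrict U) ∧ gagliardoPow s p U u < ⊤

/-- `u ∈ W^{s,p}_0(U)`: `u ∈ W^{s,p}(ℝ^N)` and `u = 0` a.e. in the complement of `U`. -/
def MemW0 {N : ℕ} (s p : ℝ) (U : Set (Space N)) (u : Space N → ℝ) : Prop :=
  MemW s p univ u ∧ ∀ᵐ x ∂(volume : Measure (Space N)), x ∉ U → u x = 0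

/-- `u ∈ L^p_loc(ℝ^N)`. -/
def MemLpLoc {N : ℕ} (p : ℝ) (u : Space N → ℝ) : Prop :=
  ∀ A : Set (Space N), IsCompact A → MemLp u (ENNReal.ofReal p) (volume.restrict A)

/-- The space `W̃^{s,p}(U)`: `u ∈ L^p_loc(ℝ^N)`, `u ∈ W^{s,p}(V)` for some open `V ⋑ U`
(`closure U` is compact and contained in `V`), and `|u|^{p-1} / (1 + |x|)^{N + ps}` has a finite
integral over `ℝ^N`. -/
def MemWTilde {N : ℕ} (s p : ℝ) (U : Set (Space N)) (u : Space N → ℝ) : Prop :=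
  MemLpLoc p u ∧
  (∃ V : Set (Space N), IsOpen V ∧ IsCompact (closure U) ∧ closure U ⊆ V ∧ MemW s p V u) ∧
  ∫⁻ x : Space N, ENNReal.ofReal (|u x| ^ (p - 1) / (1 + ‖x‖) ^ ((N : ℝ) + p * s)) < ⊤

/-- The weak form of the fractional `p`-Laplacian: the integral over `ℝ^N × ℝ^N` of
`(u(x) - u(y))^{p-1} (φ(x) - φ(y)) / |x - y|^{N + ps}`, with the odd power. It converges absolutely
for bounded `U`, `u ∈ W̃^{s,p}(U)` and `φ ∈ W^{s,p}_0(U)`. -/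
noncomputable def weakForm {N : ℕ} (s p : ℝ) (u φ : Space N → ℝ) : ℝ :=
  ∫ z : Space N × Space N,
    oddPow (u z.1 - u z.2) (p - 1) * (φ z.1 - φ z.2) / ‖z.1 - z.2‖ ^ ((N : ℝ) + p * s)

/-- `(-Δ)_p^s u ≥ c` weakly in `U`, for a constant `c`: `u ∈ W̃^{s,p}(U)`, and the weak form
dominates the functional `φ ↦ ∫_U c φ` on the nonnegative test functions `φ ∈ W^{s,p}_0(U)`. -/
def WeaklyGE {N : ℕ} (s p : ℝ) (U : Set (Space N)) (u : Space N → ℝ) (c : ℝ) : Prop :=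
  MemWTilde s p U u ∧
  ∀ φ : Space N → ℝ, MemW0 s p U φ → (∀ᵐ x ∂(volume : Measure (Space N)), 0 ≤ φ x) →
    ∫ x in U, c * φ x ≤ weakForm s p u φ

end FracPLap

namespace FracPLap

/-! The proof is a nonlocal barrier argument. The barrier is `m * profile p (‖x‖ / ρ)` with `ρ = R /
3`, that is `m (1 - |x/ρ|^b)⁺` with the dual exponent `b = p / (p - 1)`. The inequality for `u` is
tested with the excess `ψ = (barrier - u)⁺`. By monotonicity of the odd power, increments of `u` may
be replaced by those of the barrier. Pairs joining `B_{R/3}` to the annulus give more: the barrier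
vanishes on the annulus, and `u(x) ≤ m` wherever `ψ(x) > 0`, so such a pair contributes at most a
multiple of `m^{p-1}` minus a multiple of `u(y)^{p-1}` (`form_excess_le`).

The barrier is a subsolution up to a right-hand side of order `m^{p-1} ρ^{-ps}`
(`weakForm_profile_le`). Hence, if `∫ ψ > 0`, dividing by it bounds the mean of `u^{p-1}` over the
annulus by `K R^{ps}` and `m^{p-1}`, up to constants (`setAverage_rpow_le_of_excess`). Let `m` be a
small multiple of the `(p-1)`-th root of that mean, so that the `m^{p-1}` term is absorbed. Either
`ψ = 0` a.e. and `u` lies above the barrier, or the mean is at most a constant times `K R^{ps}` and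
the claimed lower bound is nonpositive.

The barrier estimate rests on inversion in the sphere of radius `|x|`, which fixes `x` and pairs
outer points with inner ones (`lintegral_profile_outer_le`). With `r = |x|/ρ` and `t = |y|/ρ`, the
inner integral becomes an outer one with increments `(t^b - r^b)^{p-1}` and weight `(r/t)^γ`, `γ = N
+ p - ps`. The defect `1 - (r/t)^γ` is at most `γ (t - r)/t`, while `(t^b - r^b)^{p-1}` is at most a
constant times `t (t - r)^{p-1}`, because `(b - 1)(p - 1) = 1`. The factors `t` cancel and leave `(t
- r)^p` (`profile_sub_rpow_le`), integrable against the kernel near the diagonal since `s < 1`. This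
works for every `p > 1`, singular range included. -/

/-! ### Odd powers and elementary power inequalities. -/

lemma oddPow_of_nonneg {a q : ℝ} (hq : 0 < q) (ha : 0 ≤ a) : oddPow a q = a ^ q := by
  unfold oddPow
  rw [abs_of_nonneg ha]
  rcases ha.eq_or_lt with rfl | h
  · simp [Real.zero_rpow hq.ne']
  · rw [← Real.rpow_add_one h.ne']; simp

lemma oddPow_neg (a q : ℝ) : oddPow (-a) q = -oddPow a q := by
  simp [oddPow]

lemma abs_oddPow {q : ℝ} (hq : 0 < q) (a : ℝ) : |oddPow a q| = |a| ^ q := by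
  rw [← oddPow_of_nonneg hq (abs_nonneg a)]
  simp [oddPow, abs_mul, abs_of_nonneg (Real.rpow_nonneg (abs_nonneg a) _)]

lemma oddPow_mul {m q : ℝ} (hq : 0 < q) (hm : 0 ≤ m) (a : ℝ) :
    oddPow (m * a) q = m ^ q * oddPow a q := by
  rw [← oddPow_of_nonneg hq hm]
  simp only [oddPow, abs_mul, Real.mul_rpow (abs_nonneg m) (abs_nonneg a)]
  ring

lemma oddPow_nonneg {a q : ℝ} (ha : 0 ≤ a) : 0 ≤ oddPow a q :=
  mul_nonneg (Real.rpow_nonneg (abs_nonneg a) _) ha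

lemma oddPow_mono {q : ℝ} (hq : 0 < q) : Monotone fun a => oddPow a q := by
  intro a b hab
  have key : ∀ {a b : ℝ}, 0 ≤ a → a ≤ b → oddPow a q ≤ oddPow b q := fun ha hab => by
    rw [oddPow_of_nonneg hq ha, oddPow_of_nonneg hq (ha.trans hab)]
    exact Real.rpow_le_rpow ha hab hq.le
  rcases le_total 0 a with ha | ha
  · exact key ha hab
  rcases le_total 0 b with hb | hb
  · have h1 := oddPow_nonneg (q := q) (neg_nonneg.2 ha)
    rw [oddPow_neg] at h1
    exact (neg_nonneg.1 h1).trans (oddPow_nonneg hb)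
  · have := key (neg_nonneg.2 hb) (neg_le_neg hab)
    rw [oddPow_neg, oddPow_neg] at this
    exact neg_le_neg_iff.1 this

@[fun_prop]
lemma measurable_oddPow (q : ℝ) : Measurable fun a => oddPow a q := by
  unfold oddPow; fun_prop

/-- Source of the gain on the annulus, with `t` the value of `u` there. Either `t / 2 ≤ m`, and `m ^
q` absorbs `(t / 2) ^ q`, or `t - m ≥ t / 2`. No convexity is used, so every `q > 0` is allowed. -/
lemma oddPow_sub_le {m t q : ℝ} (hq : 0 < q) (hm : 0 ≤ m) (ht : 0 ≤ t) :
    oddPow (m - t) q ≤ 2 * m ^ q - (t / 2) ^ q := by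
  rcases le_total (t / 2) m with h | h
  · have h1 : oddPow (m - t) q ≤ m ^ q := by
      rw [← oddPow_of_nonneg hq hm]
      exact oddPow_mono hq (by linarith)
    have h2 : (t / 2) ^ q ≤ m ^ q := Real.rpow_le_rpow (by linarith) h hq.le
    linarith
  · have h1 : (t / 2) ^ q ≤ oddPow (t - m) q := by
      rw [← oddPow_of_nonneg hq (by linarith)]
      exact oddPow_mono hq (by linarith)
    rw [← neg_sub, oddPow_neg]
    have := Real.rpow_nonneg hm q
    linarith

lemma rpow_add_le_two_rpow_mul {a b q : ℝ} (ha : 0 ≤ a) (hb : 0 ≤ b) (hq : 0 ≤ q) :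
    (a + b) ^ q ≤ 2 ^ q * (a ^ q + b ^ q) := by
  have h1 : (a + b) ^ q ≤ (2 * max a b) ^ q :=
    Real.rpow_le_rpow (by positivity) (by linarith [le_max_left a b, le_max_right a b]) hq
  rw [Real.mul_rpow zero_le_two (le_max_of_le_left ha)] at h1
  refine h1.trans (mul_le_mul_of_nonneg_left ?_ (by positivity))
  have := Real.rpow_nonneg ha q
  have := Real.rpow_nonneg hb q
  rcases max_choice a b with h | h <;> rw [h] <;> linarith

lemma rpow_sub_one_mul_le {a b p : ℝ} (ha : 0 ≤ a) (hb : 0 ≤ b) (hp : 1 < p) :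
    a ^ (p - 1) * b ≤ a ^ p + b ^ p := by
  have hM : 0 ≤ max a b := le_max_of_le_left ha
  have h1 : a ^ (p - 1) * b ≤ (max a b) ^ (p - 1) * max a b :=
    mul_le_mul (Real.rpow_le_rpow ha (le_max_left _ _) (by linarith)) (le_max_right _ _) hb
      (by positivity)
  have h2 : (max a b) ^ (p - 1) * max a b = (max a b) ^ p := by
    rw [← Real.rpow_add_one' hM (by linarith)]; simp
  rw [h2] at h1
  have := Real.rpow_nonneg ha p
  have := Real.rpow_nonneg hb p
  rcases max_choice a b with h | h <;> rw [h] at h1 <;> linarith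

lemma rpow_sub_one_le_one_add_rpow {a p : ℝ} (ha : 0 ≤ a) (hp : 1 < p) :
    a ^ (p - 1) ≤ 1 + a ^ p := by
  have := rpow_sub_one_mul_le ha zero_le_one hp
  simp at this; linarith

/-- Comparing the truncation `(g - u)⁺` against `u` and against `g`. -/
lemma oddPow_sub_mul_le {q a b c d : ℝ} (hq : 0 < q) :
    oddPow (a - b) q * (max (c - a) 0 - max (d - b) 0) ≤
      oddPow (c - d) q * (max (c - a) 0 - max (d - b) 0) := by
  -- If the first truncation is strictly larger, then `c - a > d - b`, i.e. `a - b < c - d`; the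
  -- reverse case is symmetric. So the difference of truncations has the sign that monotonicity
  -- needs.
  rcases lt_trichotomy (max (c - a) 0) (max (d - b) 0) with h | h | h
  · refine mul_le_mul_of_nonpos_right (oddPow_mono hq ?_) (by linarith)
    rcases max_choice (d - b) 0 with h' | h' <;> rw [h'] at h
    · linarith [le_max_left (c - a) 0]
    · linarith [le_max_right (c - a) 0]
  · simp [h]
  · refine mul_le_mul_of_nonneg_right (oddPow_mono hq ?_) (by linarith)
    rcases max_choice (c - a) 0 with h' | h' <;> rw [h'] at h
    · linarith [le_max_left (d - b) 0]
    · linarith [le_max_right (d - b) 0]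

/-! ### The radial profile and its one-dimensional estimates. -/

lemma one_sub_rpow_le {x b : ℝ} (hx : 0 ≤ x) (hb : 1 ≤ b) : 1 - x ^ b ≤ b * (1 - x) := by
  have := one_add_mul_self_le_rpow_one_add (s := x - 1) (by linarith) hb
  rw [add_sub_cancel] at this
  linarith

/-- Bernoulli's inequality at `r / t`, multiplied by `t ^ b`. -/
lemma rpow_sub_rpow_le {r t b : ℝ} (hr : 0 ≤ r) (ht : 0 < t) (hb : 1 ≤ b) :
    t ^ b - r ^ b ≤ b * t ^ (b - 1) * (t - r) := by
  have h := mul_le_mul_of_nonneg_left (one_sub_rpow_le (x := r / t) (by positivity) hb)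
    (Real.rpow_nonneg ht.le b)
  rw [Real.div_rpow hr ht.le] at h
  have h2 : t ^ b = t ^ (b - 1) * t := by rw [← Real.rpow_add_one ht.ne']; simp
  have h3 : t ^ b * (1 - r ^ b / t ^ b) = t ^ b - r ^ b := by
    have := (Real.rpow_pos_of_pos ht b).ne'
    field_simp
  have h4 : t ^ b * (b * (1 - r / t)) = b * t ^ (b - 1) * (t - r) := by
    rw [h2]; field_simp
  linarith

/-- The profile of the barrier, with the exponent dual to `p`. -/
noncomputable def profile (p t : ℝ) : ℝ := 1 - (min 1 t) ^ (p / (p - 1))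

lemma one_lt_dualExp {p : ℝ} (hp : 1 < p) : 1 < p / (p - 1) := by
  rw [one_lt_div (by linarith)]; linarith

lemma profile_nonneg {p t : ℝ} (hp : 1 < p) (ht : 0 ≤ t) : 0 ≤ profile p t := by
  have h := one_lt_dualExp hp
  have := Real.rpow_le_one (le_min zero_le_one ht) (min_le_left 1 t) (by linarith : 0 ≤ p / (p - 1))
  unfold profile; linarith

lemma profile_le_one {p t : ℝ} (ht : 0 ≤ t) : profile p t ≤ 1 := by
  have := Real.rpow_nonneg (le_min zero_le_one ht) (p / (p - 1))
  unfold profile; linarith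

lemma profile_eq_zero {p t : ℝ} (ht : 1 ≤ t) : profile p t = 0 := by
  simp [profile, min_eq_left ht]

lemma profile_anti {p r t : ℝ} (hp : 1 < p) (hr : 0 ≤ r) (h : r ≤ t) :
    profile p t ≤ profile p r := by
  have h0 := one_lt_dualExp hp
  have := Real.rpow_le_rpow (le_min zero_le_one hr) (min_le_min_left 1 h)
    (by linarith : 0 ≤ p / (p - 1))
  unfold profile; linarith

lemma abs_profile_sub_le {p r t : ℝ} (hp : 1 < p) (hr : 0 ≤ r) (ht : 0 ≤ t) :
    |profile p r - profile p t| ≤ p / (p - 1) * |r - t| := by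
  have h0 := one_lt_dualExp hp
  wlog h : r ≤ t generalizing r t
  · rw [abs_sub_comm, abs_sub_comm r]; exact this ht hr (le_of_not_ge h)
  rw [abs_of_nonneg (by linarith [profile_anti hp hr h]), abs_sub_comm, abs_of_nonneg (by linarith)]
  rcases ht.eq_or_lt with rfl | ht'
  · have : r = 0 := le_antisymm h hr
    simp [this]
  have hm : 0 < min 1 t := lt_min one_pos ht'
  have h1 := rpow_sub_rpow_le (r := min 1 r) (t := min 1 t) (le_min zero_le_one hr) hm h0.le
  have h2 : (min 1 t) ^ (p / (p - 1) - 1) ≤ 1 :=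
    Real.rpow_le_one hm.le (min_le_left _ _) (by linarith)
  have h3 : min 1 t - min 1 r ≤ t - r := by
    rcases min_cases 1 t with ⟨a, b⟩ | ⟨a, b⟩ <;> rcases min_cases 1 r with ⟨c, d⟩ | ⟨c, d⟩ <;>
      rw [a, c] <;> linarith
  have h3' : 0 ≤ min 1 t - min 1 r := sub_nonneg.2 (min_le_min_left 1 h)
  calc profile p r - profile p t = (min 1 t) ^ (p / (p - 1)) - (min 1 r) ^ (p / (p - 1)) := by
        unfold profile; ring
    _ ≤ p / (p - 1) * (min 1 t) ^ (p / (p - 1) - 1) * (min 1 t - min 1 r) := h1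
    _ ≤ p / (p - 1) * 1 * (t - r) := by gcongr
    _ = _ := by ring

/-- Since the dual exponent exceeds 1, `t ^ b ≤ t` on `[0, 1]`. The bound `3 / 4` is the ratio of
the radii `R / 4` and `R / 3`. -/
lemma quarter_le_profile {p t : ℝ} (hp : 1 < p) (ht : 0 ≤ t) (h : t ≤ 3 / 4) :
    1 / 4 ≤ profile p t := by
  have h0 := one_lt_dualExp hp
  have : (min 1 t) ^ (p / (p - 1)) ≤ (min 1 t) ^ (1 : ℝ) := by
    rcases ht.eq_or_lt with rfl | ht'
    · rw [min_eq_right zero_le_one, Real.zero_rpow (by linarith), Real.zero_rpow one_ne_zero]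
    · exact Real.rpow_le_rpow_of_exponent_ge (lt_min one_pos ht') (min_le_left _ _) h0.le
  rw [Real.rpow_one, min_eq_right (by linarith)] at this
  unfold profile
  rw [min_eq_right (by linarith)]
  linarith

/-- The radial estimate behind the barrier: outward increments of the profile are controlled by the
inward increments at the inverted radius, up to an error of order `d ^ p`. -/
lemma profile_sub_rpow_le {p γ : ℝ} (hp : 1 < p) (hγ : 1 ≤ γ) :
    ∃ C : ℝ, 0 < C ∧ ∀ r t d : ℝ, 0 < r → r < 1 → r < t → t - r ≤ d →
      (profile p r - profile p t) ^ (p - 1) ≤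
        (t ^ (p / (p - 1)) - r ^ (p / (p - 1))) ^ (p - 1) * (r / t) ^ γ + C * min 1 (d ^ p) := by
  set b := p / (p - 1) with hb
  have h0 : 1 < b := one_lt_dualExp hp
  have hp1 : 0 < p - 1 := by linarith
  have hbp : (b - 1) * (p - 1) = 1 := by rw [hb]; field_simp; ring
  -- The entry 1 serves `t > 2`: there `d > 1`, and the error alone dominates an increment of at
  -- most 1. The other entry serves `t ≤ 2`, where `t - r ≤ 2` allows passing to `min 1 (d ^ p)`.
  refine ⟨max 1 (b ^ (p - 1) * γ * 2 ^ p), by positivity, fun r t d hr hr1 hrt hd => ?_⟩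
  have ht : 0 < t := hr.trans hrt
  have hrt' : r ^ b ≤ t ^ b := Real.rpow_le_rpow hr.le hrt.le (by linarith)
  have ha0 : 0 ≤ profile p r - profile p t := sub_nonneg.2 (profile_anti hp hr.le hrt.le)
  have hpos : 0 ≤ (t ^ b - r ^ b) ^ (p - 1) * (r / t) ^ γ :=
    mul_nonneg (Real.rpow_nonneg (by linarith) _) (by positivity)
  have hd0 : 0 < d := by linarith
  rcases le_or_gt t 2 with h2 | h2
  · have ha : profile p r - profile p t ≤ t ^ b - r ^ b := by
      have : min 1 t ^ b ≤ t ^ b :=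
        Real.rpow_le_rpow (le_min zero_le_one ht.le) (min_le_right _ _) (by linarith)
      unfold profile
      rw [min_eq_right hr1.le]
      linarith
    have h3 : (profile p r - profile p t) ^ (p - 1) ≤ (t ^ b - r ^ b) ^ (p - 1) :=
      Real.rpow_le_rpow ha0 ha hp1.le
    have h4 : (t ^ b - r ^ b) ^ (p - 1) ≤ b ^ (p - 1) * t * (t - r) ^ (p - 1) := by
      refine (Real.rpow_le_rpow (by linarith) (rpow_sub_rpow_le hr.le ht h0.le) hp1.le).trans ?_
      rw [Real.mul_rpow (by positivity) (by linarith), Real.mul_rpow (by positivity) (by positivity),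
        ← Real.rpow_mul ht.le, hbp, Real.rpow_one]
    have h5 : 1 - (r / t) ^ γ ≤ γ * (1 - r / t) := one_sub_rpow_le (by positivity) hγ
    have h5' : 0 ≤ 1 - (r / t) ^ γ := by
      have := Real.rpow_le_one (by positivity : 0 ≤ r / t) ((div_le_one ht).2 hrt.le)
        (by linarith : 0 ≤ γ)
      linarith
    -- The factor `t` from `h4` cancels the denominator of `1 - r / t`, giving one more power of `t
    -- - r`.
    have h6 : (t ^ b - r ^ b) ^ (p - 1) * (1 - (r / t) ^ γ) ≤ b ^ (p - 1) * γ * (t - r) ^ p := by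
      have h7 : (t - r) ^ p = (t - r) ^ (p - 1) * (t - r) := by
        rw [← Real.rpow_add_one (by linarith)]; simp
      calc _ ≤ (b ^ (p - 1) * t * (t - r) ^ (p - 1)) * (γ * (1 - r / t)) :=
            mul_le_mul h4 h5 h5' (mul_nonneg (by positivity) (Real.rpow_nonneg (by linarith) _))
        _ = _ := by rw [h7]; field_simp
    have h8 : (t - r) ^ p ≤ 2 ^ p * min 1 (d ^ p) := by
      rw [mul_min_of_nonneg _ _ (by positivity)]
      refine le_min ?_ ?_
      · rw [mul_one]; exact Real.rpow_le_rpow (by linarith) (by linarith) (by linarith)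
      · rw [← Real.mul_rpow zero_le_two hd0.le]
        exact Real.rpow_le_rpow (by linarith) (by linarith) (by linarith)
    have h9 : b ^ (p - 1) * γ * (t - r) ^ p ≤ max 1 (b ^ (p - 1) * γ * 2 ^ p) * min 1 (d ^ p) :=
      calc _ ≤ b ^ (p - 1) * γ * (2 ^ p * min 1 (d ^ p)) := by gcongr
        _ = (b ^ (p - 1) * γ * 2 ^ p) * min 1 (d ^ p) := by ring
        _ ≤ _ := by gcongr; exact le_max_right _ _
    linarith
  · have ha : profile p r - profile p t ≤ 1 := by
      linarith [profile_le_one (p := p) hr.le, profile_nonneg hp ht.le]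
    have h3 : (profile p r - profile p t) ^ (p - 1) ≤ 1 := Real.rpow_le_one ha0 ha hp1.le
    have h4 : min 1 (d ^ p) = 1 := min_eq_left (Real.one_le_rpow (by linarith) (by linarith))
    rw [h4]
    linarith [le_max_left 1 (b ^ (p - 1) * γ * 2 ^ p)]

/-! ### The truncated singular kernel and its scaling. -/

/-- In polar coordinates the radial density is `t ^ (p - p * s - 1)` near 0 and `t ^ (-p * s - 1)`
at infinity, integrable because `s < 1` and `s > 0` respectively. -/
lemma integrable_min_one_kernel {N : ℕ} (hN : 1 ≤ N) {s p : ℝ} (hs0 : 0 < s) (hs1 : s < 1)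
    (hp : 1 < p) :
    Integrable fun h : Space N => min 1 (‖h‖ ^ p) / ‖h‖ ^ ((N : ℝ) + p * s) := by
  have : Nonempty (Fin N) := ⟨⟨0, hN⟩⟩
  have hps : 0 < p * s := by positivity
  have hps' : p * s < p := by nlinarith
  rw [integrable_fun_norm_addHaar volume (f := fun t : ℝ => min 1 (t ^ p) / t ^ ((N : ℝ) + p * s)),
    finrank_euclideanSpace_fin, ← Ioo_union_Ici_eq_Ioi one_pos]
  have hcast : ((N - 1 : ℕ) : ℝ) = (N : ℝ) - 1 := by push_cast [hN]; ring
  refine IntegrableOn.union ?_ ?_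
  · have h : IntegrableOn (fun t : ℝ => t ^ (p - p * s - 1)) (Ioo 0 1) :=
      (intervalIntegral.integrableOn_Ioo_rpow_iff one_pos).2 (by linarith)
    refine h.congr_fun (fun t ht => ?_) measurableSet_Ioo
    have ht0 : 0 < t := ht.1
    simp only [smul_eq_mul]
    rw [min_eq_right (Real.rpow_le_one ht0.le ht.2.le (by linarith)), ← Real.rpow_natCast t (N - 1),
      hcast, ← Real.rpow_sub ht0, ← Real.rpow_add ht0]
    congr 1; ring
  · rw [integrableOn_Ici_iff_integrableOn_Ioi]
    have h : IntegrableOn (fun t : ℝ => t ^ (- p * s - 1)) (Ioi 1) :=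
      integrableOn_Ioi_rpow_of_lt (by linarith) one_pos
    refine h.congr_fun (fun t ht => ?_) measurableSet_Ioi
    have ht1 : 1 < t := ht
    have ht0 : 0 < t := one_pos.trans ht1
    simp only [smul_eq_mul]
    rw [min_eq_left (Real.one_le_rpow ht1.le (by linarith)), ← Real.rpow_natCast t (N - 1), hcast,
      one_div, ← Real.rpow_neg ht0.le, ← Real.rpow_add ht0]
    congr 1; ring

lemma integral_min_one_kernel_scaled {N : ℕ} {s p ρ : ℝ} (hρ : 0 < ρ) :
    ∫ h : Space N, min 1 ((‖h‖ / ρ) ^ p) / ‖h‖ ^ ((N : ℝ) + p * s) =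
      ρ ^ (-(p * s)) * ∫ h : Space N, min 1 (‖h‖ ^ p) / ‖h‖ ^ ((N : ℝ) + p * s) := by
  have h := Measure.integral_comp_smul (volume : Measure (Space N))
    (fun h : Space N => min 1 (‖h‖ ^ p) / ‖h‖ ^ ((N : ℝ) + p * s)) ρ⁻¹
  have h1 : ∀ x : Space N, ‖ρ⁻¹ • x‖ = ‖x‖ / ρ := fun x => by
    rw [norm_smul, Real.norm_of_nonneg (by positivity)]; field_simp
  simp only [h1, finrank_euclideanSpace_fin] at h
  have h2 : ∀ x : Space N, min 1 ((‖x‖ / ρ) ^ p) / (‖x‖ / ρ) ^ ((N : ℝ) + p * s) =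
      ρ ^ ((N : ℝ) + p * s) * (min 1 ((‖x‖ / ρ) ^ p) / ‖x‖ ^ ((N : ℝ) + p * s)) := fun x => by
    rw [Real.div_rpow (norm_nonneg x) hρ.le ((N : ℝ) + p * s)]
    rw [div_div_eq_mul_div]; ring
  simp only [h2, integral_const_mul] at h
  have h3 : ρ ^ ((N : ℝ) + p * s) ≠ 0 := (Real.rpow_pos_of_pos hρ _).ne'
  rw [abs_of_nonneg (by positivity), inv_pow, inv_inv, smul_eq_mul] at h
  rw [eq_comm, ← mul_right_inj' h3, h, ← mul_assoc, ← Real.rpow_add hρ, ← Real.rpow_natCast]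
  congr 2; ring

lemma integrable_min_one_kernel_scaled {N : ℕ} (hN : 1 ≤ N) {s p ρ : ℝ} (hs0 : 0 < s) (hs1 : s < 1)
    (hp : 1 < p) (hρ : 0 < ρ) :
    Integrable fun h : Space N => min 1 ((‖h‖ / ρ) ^ p) / ‖h‖ ^ ((N : ℝ) + p * s) := by
  have h := ((integrable_min_one_kernel hN hs0 hs1 hp).comp_smul (inv_pos.2 hρ).ne').const_mul
    (ρ ^ (-((N : ℝ) + p * s)))
  refine h.congr (Filter.Eventually.of_forall fun x => ?_)
  have h1 : ‖ρ⁻¹ • x‖ = ‖x‖ / ρ := by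
    rw [norm_smul, Real.norm_of_nonneg (by positivity)]; field_simp
  have h3 : ρ ^ ((N : ℝ) + p * s) ≠ 0 := (Real.rpow_pos_of_pos hρ _).ne'
  simp only [h1]
  rw [Real.div_rpow (norm_nonneg x) hρ.le ((N : ℝ) + p * s), Real.rpow_neg hρ.le,
    div_div_eq_mul_div]
  field_simp

lemma lintegral_min_one_kernel_scaled {N : ℕ} (hN : 1 ≤ N) {s p ρ : ℝ} (hs0 : 0 < s) (hs1 : s < 1)
    (hp : 1 < p) (hρ : 0 < ρ) (x : Space N) :
    ∫⁻ y : Space N, ENNReal.ofReal (min 1 ((‖x - y‖ / ρ) ^ p) / ‖x - y‖ ^ ((N : ℝ) + p * s)) =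
      ENNReal.ofReal (ρ ^ (-(p * s)) *
        ∫ h : Space N, min 1 (‖h‖ ^ p) / ‖h‖ ^ ((N : ℝ) + p * s)) := by
  rw [← integral_min_one_kernel_scaled hρ, ofReal_integral_eq_lintegral_ofReal
    (integrable_min_one_kernel_scaled hN hs0 hs1 hp hρ)
    (Filter.Eventually.of_forall fun h => by positivity)]
  exact lintegral_sub_left_eq_self
    (fun h : Space N => ENNReal.ofReal (min 1 ((‖h‖ / ρ) ^ p) / ‖h‖ ^ ((N : ℝ) + p * s))) x

/-! ### Inversion, and the comparison of outer and inner singular integrals. -/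

open EuclideanGeometry in
/-- Change of variables under inversion in the sphere of radius `r` about the origin. -/
lemma lintegral_image_inversion {N : ℕ} {r : ℝ} (hr : r ≠ 0) {S : Set (Space N)}
    (hS : MeasurableSet S) (h0 : (0 : Space N) ∉ S) (f : Space N → ENNReal) :
    ∫⁻ y in inversion 0 r '' S, f y =
      ∫⁻ y in S, ENNReal.ofReal ((r / ‖y‖) ^ (2 * N)) * f (inversion 0 r y) := by
  have hd : ∀ x ∈ S, HasFDerivWithinAt (inversion (0 : Space N) r)
      ((r / dist x 0) ^ 2 • ((ℝ ∙ (x - 0))ᗮ.reflection : Space N →L[ℝ] Space N)) S x := by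
    intro x hx
    have hx0 : x ≠ 0 := by rintro rfl; exact h0 hx
    exact (hasFDerivAt_inversion hx0).hasFDerivWithinAt
  rw [lintegral_image_eq_lintegral_abs_det_fderiv_mul volume hS hd
    ((inversion_injective 0 hr).injOn)]
  refine setLIntegral_congr_fun hS fun x hx => ?_
  congr 2
  -- The derivative is a dilation by `(r / ‖x‖) ^ 2` composed with a reflection, of determinant
  -- `±1`.
  have : ((r / dist x 0) ^ 2 • ((ℝ ∙ (x - 0))ᗮ.reflection : Space N →L[ℝ] Space N)).det =
      ((r / dist x 0) ^ 2) ^ N * LinearMap.det ((ℝ ∙ (x - 0))ᗮ.reflection).toLinearMap := by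
    rw [ContinuousLinearMap.det, ContinuousLinearMap.toLinearMap_smul, LinearMap.det_smul,
      finrank_euclideanSpace_fin]
    rfl
  rw [this, Submodule.det_reflection, abs_mul, abs_pow, abs_pow (-1 : ℝ), abs_neg, abs_one, one_pow,
    mul_one, dist_zero_right, abs_of_nonneg (by positivity), ← pow_mul]

open EuclideanGeometry in
/-- The singular integral of the barrier outside the ball through `x` is bounded by the one inside,
up to an error which is uniform in `x`. -/
lemma lintegral_profile_outer_le {N : ℕ} (hN : 1 ≤ N) {s p : ℝ} (hs0 : 0 < s) (hs1 : s < 1)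
    (hp : 1 < p) :
    ∃ C : ℝ, 0 < C ∧ ∀ (ρ c : ℝ) (x : Space N), 0 < ρ → 1 ≤ c → 0 < ‖x‖ → ‖x‖ < ρ →
      ∫⁻ y in {y : Space N | c * ‖x‖ < ‖y‖}, ENNReal.ofReal
        ((profile p (‖x‖ / ρ) - profile p (‖y‖ / ρ)) ^ (p - 1) / ‖x - y‖ ^ ((N : ℝ) + p * s)) ≤
      (∫⁻ y in {y : Space N | c * ‖y‖ < ‖x‖}, ENNReal.ofReal
        ((profile p (‖y‖ / ρ) - profile p (‖x‖ / ρ)) ^ (p - 1) / ‖x - y‖ ^ ((N : ℝ) + p * s))) +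
      ENNReal.ofReal (C * ρ ^ (-(p * s))) := by
  have hN' : (1 : ℝ) ≤ N := by exact_mod_cast hN
  have hγ : 1 ≤ p + N - p * s := by nlinarith
  obtain ⟨C, hC, H⟩ := profile_sub_rpow_le hp hγ
  set Q := ∫ h : Space N, min 1 (‖h‖ ^ p) / ‖h‖ ^ ((N : ℝ) + p * s) with hQ
  have hQ0 : 0 ≤ Q := integral_nonneg fun h => by positivity
  -- Adding 1 to `Q` only secures a positive constant.
  refine ⟨C * (Q + 1), by positivity, fun ρ c x hρ hc hx0 hxρ => ?_⟩
  have hb := one_lt_dualExp hp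
  have hbp : p / (p - 1) * (p - 1) = p := by
    have : p - 1 ≠ 0 := by linarith
    field_simp
  set f : Space N → ENNReal := fun y => ENNReal.ofReal
        ((profile p (‖y‖ / ρ) - profile p (‖x‖ / ρ)) ^ (p - 1) / ‖x - y‖ ^ ((N : ℝ) + p * s)) with hf
  set S : Set (Space N) := {y | c * ‖x‖ < ‖y‖} with hS
  have hSm : MeasurableSet S := measurableSet_lt measurable_const measurable_norm
  have hS0 : (0 : Space N) ∉ S := by
    simp only [hS, mem_ofPred_eq, norm_zero, not_lt]; positivity
  have hxn : x ≠ 0 := norm_pos_iff.1 hx0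
  have key : ∀ y ∈ S, ENNReal.ofReal
        ((profile p (‖x‖ / ρ) - profile p (‖y‖ / ρ)) ^ (p - 1) / ‖x - y‖ ^ ((N : ℝ) + p * s)) ≤
      ENNReal.ofReal ((‖x‖ / ‖y‖) ^ (2 * N)) * f (inversion 0 ‖x‖ y) + ENNReal.ofReal
        (C * (min 1 ((‖x - y‖ / ρ) ^ p) / ‖x - y‖ ^ ((N : ℝ) + p * s))) := by
    intro y hy
    have hxy : ‖x‖ < ‖y‖ := lt_of_le_of_lt (le_mul_of_one_le_left hx0.le hc) hy
    have hy0 : 0 < ‖y‖ := hx0.trans hxy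
    have hyn : y ≠ 0 := norm_pos_iff.1 hy0
    have hd : 0 < ‖x - y‖ := by
      rw [norm_pos_iff, sub_ne_zero]; rintro rfl; exact lt_irrefl _ hxy
    have h1 : ‖inversion 0 ‖x‖ y‖ = ‖x‖ ^ 2 / ‖y‖ := by
      simpa using dist_inversion_center (0 : Space N) y ‖x‖
    have h2 : ‖x - inversion 0 ‖x‖ y‖ = ‖x‖ / ‖y‖ * ‖x - y‖ := by
      have := dist_inversion_inversion hxn hyn ‖x‖
      rw [inversion_of_mem_sphere (by simp)] at this
      rw [← dist_eq_norm, this, dist_zero_right, dist_zero_right, dist_eq_norm]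
      field_simp
    have hk : 0 < ‖x - y‖ ^ ((N : ℝ) + p * s) := Real.rpow_pos_of_pos hd _
    set r := ‖x‖ / ρ with hr
    set t := ‖y‖ / ρ with ht
    have hr0 : 0 < r := by positivity
    have ht0 : 0 < t := by positivity
    have hr1 : r < 1 := (div_lt_one hρ).2 hxρ
    have hrt : r < t := div_lt_div_of_pos_right hxy hρ
    have hrt' : ‖x‖ / ‖y‖ = r / t := by rw [hr, ht]; field_simp
    have hz : ‖inversion 0 ‖x‖ y‖ / ρ = r / t * r := by rw [h1, hr, ht]; field_simp
    have hq : r / t < 1 := (div_lt_one ht0).2 hrt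
    have hzr : r / t * r < r := by nlinarith
    have hprof : profile p (r / t * r) - profile p r =
        (r / t) ^ (p / (p - 1)) * (t ^ (p / (p - 1)) - r ^ (p / (p - 1))) := by
      unfold profile
      rw [min_eq_right hr1.le, min_eq_right (hzr.trans hr1).le,
        Real.mul_rpow (by positivity) hr0.le, Real.div_rpow hr0.le ht0.le]
      have := (Real.rpow_pos_of_pos ht0 (p / (p - 1))).ne'
      field_simp
      ring
    have hmono : 0 ≤ t ^ (p / (p - 1)) - r ^ (p / (p - 1)) :=
      sub_nonneg.2 (Real.rpow_le_rpow hr0.le hrt.le (by linarith))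
    have hfz : ENNReal.ofReal ((‖x‖ / ‖y‖) ^ (2 * N)) * f (inversion 0 ‖x‖ y) =
        ENNReal.ofReal ((t ^ (p / (p - 1)) - r ^ (p / (p - 1))) ^ (p - 1) *
          (r / t) ^ (p + N - p * s) / ‖x - y‖ ^ ((N : ℝ) + p * s)) := by
      rw [hf, ← ENNReal.ofReal_mul (by positivity)]
      congr 1
      rw [hz, h2, hprof, hrt', Real.mul_rpow (by positivity) hmono, ← Real.rpow_mul (by positivity),
        hbp, Real.mul_rpow (by positivity) hd.le]
      -- The exponent collects `2N` from the Jacobian, `p` from the profile increments and `-(N +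
      -- ps)` from the kernel.
      have e : (r / t) ^ (p + N - p * s) =
          (r / t) ^ (2 * N) * (r / t) ^ p / (r / t) ^ ((N : ℝ) + p * s) := by
        rw [← Real.rpow_natCast (r / t), ← Real.rpow_add (by positivity),
          ← Real.rpow_sub (by positivity)]
        congr 1; push_cast; ring
      rw [e]
      have : (r / t) ^ ((N : ℝ) + p * s) ≠ 0 := (Real.rpow_pos_of_pos (by positivity) _).ne'
      field_simp
    have hdist : t - r ≤ ‖x - y‖ / ρ := by
      rw [hr, ht, ← sub_div]
      gcongr
      rw [norm_sub_rev]; exact norm_sub_norm_le y x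
    rw [hfz, ← ENNReal.ofReal_add (by positivity) (by positivity)]
    refine ENNReal.ofReal_le_ofReal ?_
    rw [← mul_div_assoc, ← add_div]
    gcongr
    exact H r t _ hr0 hr1 hrt hdist
  calc _ ≤ ∫⁻ y in S, (ENNReal.ofReal ((‖x‖ / ‖y‖) ^ (2 * N)) * f (inversion 0 ‖x‖ y) +
        ENNReal.ofReal (C * (min 1 ((‖x - y‖ / ρ) ^ p) / ‖x - y‖ ^ ((N : ℝ) + p * s)))) :=
        setLIntegral_mono' hSm key
    _ = (∫⁻ y in S, ENNReal.ofReal ((‖x‖ / ‖y‖) ^ (2 * N)) * f (inversion 0 ‖x‖ y)) +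
        ∫⁻ y in S, ENNReal.ofReal (C * (min 1 ((‖x - y‖ / ρ) ^ p) / ‖x - y‖ ^ ((N : ℝ) + p * s))) :=
        lintegral_add_right _ (by fun_prop)
    _ = (∫⁻ y in inversion 0 ‖x‖ '' S, f y) +
        ∫⁻ y in S, ENNReal.ofReal (C * (min 1 ((‖x - y‖ / ρ) ^ p) / ‖x - y‖ ^ ((N : ℝ) + p * s))) := by
        rw [lintegral_image_inversion hx0.ne' hSm hS0]
    _ ≤ _ := by
      gcongr ?_ + ?_
      · refine lintegral_mono_set ?_
        rintro _ ⟨y, hy, rfl⟩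
        have hy0 : 0 < ‖y‖ := 
          lt_of_le_of_lt (by positivity : 0 ≤ c * ‖x‖) hy
        have h1 : ‖inversion 0 ‖x‖ y‖ = ‖x‖ ^ 2 / ‖y‖ := by
          simpa using dist_inversion_center (0 : Space N) y ‖x‖
        -- As the inverted radius is `‖x‖ ^ 2 / ‖y‖`, inversion turns `c * ‖x‖ < ‖y‖` into the
        -- mirrored condition: the cut around the sphere is preserved.
        rw [mem_ofPred_eq, h1, ← mul_div_assoc, div_lt_iff₀ hy0, sq, ← mul_assoc, mul_comm]
        exact mul_lt_mul_of_pos_left hy hx0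
      · refine (setLIntegral_le_lintegral _ _).trans ?_
        simp only [ENNReal.ofReal_mul hC.le]
        rw [lintegral_const_mul _ (by fun_prop),
          lintegral_min_one_kernel_scaled hN hs0 hs1 hp hρ, ← hQ, ← ENNReal.ofReal_mul hC.le]
        refine ENNReal.ofReal_le_ofReal ?_
        have := Real.rpow_nonneg hρ.le (-(p * s))
        nlinarith [mul_nonneg hC.le this]

/-! ### The weak form of the barrier. -/

@[fun_prop]
lemma measurable_profile (p : ℝ) : Measurable (profile p) := by
  unfold profile; fun_prop

lemma integrable_comp_swap {N : ℕ} {f : Space N × Space N → ℝ} (hf : Integrable f) :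
    Integrable fun z : Space N × Space N => f z.swap := by
  rw [Measure.volume_eq_prod] at hf ⊢
  exact hf.swap

lemma setLIntegral_prod_eq {X Y : Type*} [MeasurableSpace X] [MeasurableSpace Y] {μ : Measure X}
    {ν : Measure Y} [SFinite μ] [SFinite ν] {S : Set (X × Y)} (hS : MeasurableSet S)
    {f : X × Y → ENNReal} (hf : Measurable f) :
    ∫⁻ z in S, f z ∂(μ.prod ν) = ∫⁻ x, ∫⁻ y in {y | (x, y) ∈ S}, f (x, y) ∂ν ∂μ := by
  rw [← lintegral_indicator hS, lintegral_prod _ (hf.indicator hS).aemeasurable]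
  refine lintegral_congr fun x => ?_
  change _ = ∫⁻ y in Prod.mk x ⁻¹' S, f (x, y) ∂ν
  rw [← lintegral_indicator (measurable_prodMk_left hS)]
  rfl

lemma setLIntegral_prod_symm_eq {X Y : Type*} [MeasurableSpace X] [MeasurableSpace Y]
    {μ : Measure X} {ν : Measure Y} [SFinite μ] [SFinite ν] {S : Set (X × Y)}
    (hS : MeasurableSet S) {f : X × Y → ENNReal} (hf : Measurable f) :
    ∫⁻ z in S, f z ∂(μ.prod ν) = ∫⁻ y, ∫⁻ x in {x | (x, y) ∈ S}, f (x, y) ∂μ ∂ν := by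
  rw [← lintegral_indicator hS, lintegral_prod_symm _ (hf.indicator hS).aemeasurable]
  refine lintegral_congr fun y => ?_
  change _ = ∫⁻ x in (fun x => (x, y)) ⁻¹' S, f (x, y) ∂μ
  rw [← lintegral_indicator (measurable_prodMk_right hS)]
  rfl

/-- Away from the diagonal, the singular integral of the barrier inside the ball through `x` is
bounded uniformly in `x`. -/
lemma exists_lintegral_profile_inner_le {N : ℕ} {s p ρ c : ℝ} (hs0 : 0 < s)
    (hs1 : s < 1) (hp : 1 < p) (hρ : 0 < ρ) (hc : 1 < c) :
    ∃ B : ENNReal, B < ⊤ ∧ ∀ x : Space N, ‖x‖ < ρ →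
      ∫⁻ y in {y : Space N | c * ‖y‖ < ‖x‖}, ENNReal.ofReal
        ((profile p (‖y‖ / ρ) - profile p (‖x‖ / ρ)) ^ (p - 1) / ‖x - y‖ ^ ((N : ℝ) + p * s)) ≤
      B := by
  have hp1 : 0 < p - 1 := by linarith
  have hb := one_lt_dualExp hp
  have hbp : p / (p - 1) * (p - 1) = p := by field_simp
  have hps : 0 < p * s := by positivity
  have hps' : p * s < p := by nlinarith
  have hc0 : 0 < c := by linarith
  have hk0 : 0 < 1 - c⁻¹ := by
    have := inv_lt_one_of_one_lt₀ hc
    linarith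
  -- Numerator, kernel and ball volume scale as `‖x‖ ^ p`, `‖x‖ ^ (-(N + ps))` and `‖x‖ ^ N`. The
  -- product `‖x‖ ^ (p - p * s)` has a positive exponent, hence the bound by its value at `ρ`.
  refine ⟨ENNReal.ofReal (ρ ^ (-p) * (1 - c⁻¹) ^ (-((N : ℝ) + p * s)) * ρ ^ (p - p * s)) *
    volume (Metric.ball (0 : Space N) 1), ENNReal.mul_lt_top ENNReal.ofReal_lt_top
      measure_ball_lt_top, fun x hx => ?_⟩
  rcases (norm_nonneg x).eq_or_lt with h0 | h0
  · have : {y : Space N | c * ‖y‖ < ‖x‖} = ∅ := by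
      ext y
      simp only [mem_ofPred_eq, mem_empty_iff_false, iff_false, not_lt, ← h0]
      positivity
    simp [this]
  have key : ∀ y ∈ {y : Space N | c * ‖y‖ < ‖x‖}, ENNReal.ofReal
        ((profile p (‖y‖ / ρ) - profile p (‖x‖ / ρ)) ^ (p - 1) / ‖x - y‖ ^ ((N : ℝ) + p * s)) ≤
      ENNReal.ofReal ((‖x‖ / ρ) ^ p * ((1 - c⁻¹) * ‖x‖) ^ (-((N : ℝ) + p * s))) := by
    intro y hy
    have hy : c * ‖y‖ < ‖x‖ := hy
    have hyx : ‖y‖ ≤ c⁻¹ * ‖x‖ := by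
      rw [inv_mul_eq_div, le_div_iff₀ hc0]; linarith
    have hyx' : ‖y‖ ≤ ‖x‖ := by nlinarith
    have hd : (1 - c⁻¹) * ‖x‖ ≤ ‖x - y‖ := by
      have := norm_sub_norm_le x y
      linarith
    have h1 : 0 ≤ profile p (‖y‖ / ρ) - profile p (‖x‖ / ρ) :=
      sub_nonneg.2 (profile_anti hp (by positivity) (by gcongr))
    have h2 : profile p (‖y‖ / ρ) - profile p (‖x‖ / ρ) ≤ (‖x‖ / ρ) ^ (p / (p - 1)) := by
      have := profile_le_one (p := p) (t := ‖y‖ / ρ) (by positivity)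
      have e : profile p (‖x‖ / ρ) = 1 - (‖x‖ / ρ) ^ (p / (p - 1)) := by
        rw [profile, min_eq_right ((div_le_one hρ).2 hx.le)]
      linarith
    refine ENNReal.ofReal_le_ofReal ?_
    rw [Real.rpow_neg (by positivity), ← div_eq_mul_inv]
    have h3 : (profile p (‖y‖ / ρ) - profile p (‖x‖ / ρ)) ^ (p - 1) ≤ (‖x‖ / ρ) ^ p := by
      refine (Real.rpow_le_rpow h1 h2 hp1.le).trans_eq ?_
      rw [← Real.rpow_mul (by positivity), hbp]
    have h4 : 0 < ((1 - c⁻¹) * ‖x‖) ^ ((N : ℝ) + p * s) := by positivity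
    gcongr
  calc _ ≤ ∫⁻ y in {y : Space N | c * ‖y‖ < ‖x‖},
        ENNReal.ofReal ((‖x‖ / ρ) ^ p * ((1 - c⁻¹) * ‖x‖) ^ (-((N : ℝ) + p * s))) :=
        setLIntegral_mono' (measurableSet_lt (by fun_prop) measurable_const) key
    _ ≤ ENNReal.ofReal ((‖x‖ / ρ) ^ p * ((1 - c⁻¹) * ‖x‖) ^ (-((N : ℝ) + p * s))) *
        volume (Metric.ball (0 : Space N) ‖x‖) := by
      rw [setLIntegral_const]
      gcongr
      intro y hy
      have hy : c * ‖y‖ < ‖x‖ := hy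
      rw [mem_ball_zero_iff]
      nlinarith [norm_nonneg y]
    _ = ENNReal.ofReal (ρ ^ (-p) * (1 - c⁻¹) ^ (-((N : ℝ) + p * s)) * ‖x‖ ^ (p - p * s)) *
        volume (Metric.ball (0 : Space N) 1) := by
      rw [Measure.addHaar_ball_of_pos _ _ h0, finrank_euclideanSpace_fin, ← mul_assoc,
        ← ENNReal.ofReal_mul (by positivity)]
      congr 2
      rw [Real.div_rpow h0.le hρ.le, Real.mul_rpow hk0.le h0.le, Real.rpow_neg hρ.le]
      have : ‖x‖ ^ (p - p * s) = ‖x‖ ^ p * ‖x‖ ^ (-((N : ℝ) + p * s)) * ‖x‖ ^ N := by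
        rw [← Real.rpow_natCast, ← Real.rpow_add h0, ← Real.rpow_add h0]
        congr 1; ring
      rw [this]
      field_simp
    _ ≤ _ := by
      gcongr

/-- The barrier is a weak subsolution up to a bounded right-hand side: the truncated form. -/
lemma setIntegral_profile_le {N : ℕ} (hN : 1 ≤ N) {s p : ℝ} (hs0 : 0 < s) (hs1 : s < 1)
    (hp : 1 < p) :
    ∃ C : ℝ, 0 < C ∧ ∀ (ρ c : ℝ) (ψ : Space N → ℝ), 0 < ρ → 1 < c → Measurable ψ →
      (∀ x, 0 ≤ ψ x) → (∀ x, ρ ≤ ‖x‖ → ψ x = 0) → Integrable ψ →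
      ∫ z in {z : Space N × Space N | c * ‖z.1‖ < ‖z.2‖},
        oddPow (profile p (‖z.1‖ / ρ) - profile p (‖z.2‖ / ρ)) (p - 1) * (ψ z.1 - ψ z.2) /
          ‖z.1 - z.2‖ ^ ((N : ℝ) + p * s) ≤ C * ρ ^ (-(p * s)) * ∫ x, ψ x := by
  obtain ⟨C, hC, H⟩ := lintegral_profile_outer_le hN hs0 hs1 hp
  refine ⟨C, hC, fun ρ c ψ hρ hc hψm hψ0 hψρ hψi => ?_⟩
  have : Nonempty (Fin N) := ⟨⟨0, hN⟩⟩
  have hp1 : 0 < p - 1 := by linarith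
  obtain ⟨B, hB, HB⟩ := exists_lintegral_profile_inner_le (N := N) hs0 hs1 hp hρ hc
  set S : Set (Space N × Space N) := {z | c * ‖z.1‖ < ‖z.2‖} with hS
  have hSm : MeasurableSet S := measurableSet_lt (by fun_prop) (by fun_prop)
  set G : Space N × Space N → ℝ := fun z =>
    (profile p (‖z.1‖ / ρ) - profile p (‖z.2‖ / ρ)) ^ (p - 1) /
      ‖z.1 - z.2‖ ^ ((N : ℝ) + p * s) with hG
  have hGm : Measurable G := by fun_prop
  have hinc : ∀ z ∈ S, 0 ≤ profile p (‖z.1‖ / ρ) - profile p (‖z.2‖ / ρ) := fun z hz => by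
    have hz : c * ‖z.1‖ < ‖z.2‖ := hz
    have : ‖z.1‖ ≤ ‖z.2‖ := by nlinarith [norm_nonneg z.1]
    exact sub_nonneg.2 (profile_anti hp (by positivity) (by gcongr))
  have hG0 : ∀ z ∈ S, 0 ≤ G z := fun z hz =>
    div_nonneg (Real.rpow_nonneg (hinc z hz) _) (by positivity)
  set I : Space N → ENNReal := fun x => ∫⁻ y in {y : Space N | c * ‖y‖ < ‖x‖}, ENNReal.ofReal
    ((profile p (‖y‖ / ρ) - profile p (‖x‖ / ρ)) ^ (p - 1) / ‖x - y‖ ^ ((N : ℝ) + p * s)) with hI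
  have hb : ∫⁻ z in S, ENNReal.ofReal (G z * ψ z.2) = ∫⁻ x, ENNReal.ofReal (ψ x) * I x := by
    rw [Measure.volume_eq_prod, setLIntegral_prod_symm_eq hSm (by fun_prop)]
    refine lintegral_congr fun y => ?_
    rw [hI, ← lintegral_const_mul _ (by fun_prop)]
    refine lintegral_congr fun x => ?_
    rw [mul_comm, ENNReal.ofReal_mul (hψ0 y), norm_sub_rev]
  have ha : ∫⁻ z in S, ENNReal.ofReal (G z * ψ z.1) ≤
      (∫⁻ z in S, ENNReal.ofReal (G z * ψ z.2)) +
        ENNReal.ofReal (C * ρ ^ (-(p * s)) * ∫ x, ψ x) := by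
    have e : ENNReal.ofReal (C * ρ ^ (-(p * s)) * ∫ x, ψ x) =
        ∫⁻ x, ENNReal.ofReal (ψ x) * ENNReal.ofReal (C * ρ ^ (-(p * s))) := by
      rw [lintegral_mul_const _ (by fun_prop), ENNReal.ofReal_mul (by positivity), mul_comm,
        ofReal_integral_eq_lintegral_ofReal hψi (Filter.Eventually.of_forall hψ0)]
    rw [hb, e, ← lintegral_add_right _ (by fun_prop), Measure.volume_eq_prod,
      setLIntegral_prod_eq hSm (by fun_prop)]
    refine lintegral_mono_ae ?_
    have h0 : ∀ᵐ x : Space N, x ≠ 0 := by simp [ae_iff, measure_singleton]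
    filter_upwards [h0] with x hx
    rcases lt_or_ge ‖x‖ ρ with h | h
    · rw [← mul_add]
      refine le_trans (le_of_eq ?_) (mul_le_mul_right (H ρ c x hρ hc.le (norm_pos_iff.2 hx) h) _)
      rw [← lintegral_const_mul _ (by fun_prop)]
      refine lintegral_congr fun y => ?_
      rw [mul_comm, ENNReal.ofReal_mul (hψ0 x)]
    · simp [hψρ x h]
  -- The cut `c > 1` serves to make this finite, so that the form splits into an outer and an inner
  -- integral; without the cut each of them may diverge.
  have hbfin : ∫⁻ z in S, ENNReal.ofReal (G z * ψ z.2) < ⊤ := by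
    rw [hb]
    calc _ ≤ ∫⁻ x, ENNReal.ofReal (ψ x) * B := by
          refine lintegral_mono fun x => ?_
          rcases lt_or_ge ‖x‖ ρ with h | h
          · exact mul_le_mul_right (HB x h) _
          · simp [hψρ x h]
      _ < ⊤ := by
        rw [lintegral_mul_const _ (by fun_prop),
          ← ofReal_integral_eq_lintegral_ofReal hψi (Filter.Eventually.of_forall hψ0)]
        exact ENNReal.mul_lt_top ENNReal.ofReal_lt_top hB
  have hafin : ∫⁻ z in S, ENNReal.ofReal (G z * ψ z.1) < ⊤ :=
    ha.trans_lt (ENNReal.add_lt_top.2 ⟨hbfin, ENNReal.ofReal_lt_top⟩)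
  have hn : ∀ g : Space N × Space N → Space N, 0 ≤ᵐ[volume.restrict S] fun z => G z * ψ (g z) :=
    fun g => (ae_restrict_iff' hSm).2 (Filter.Eventually.of_forall fun z hz =>
      mul_nonneg (hG0 z hz) (hψ0 _))
  have hi1 : IntegrableOn (fun z => G z * ψ z.1) S := by
    refine ⟨by fun_prop, ?_⟩
    rw [hasFiniteIntegral_iff_ofReal (hn Prod.fst)]
    exact hafin
  have hi2 : IntegrableOn (fun z => G z * ψ z.2) S := by
    refine ⟨by fun_prop, ?_⟩
    rw [hasFiniteIntegral_iff_ofReal (hn Prod.snd)]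
    exact hbfin
  have hF : ∫ z in S, oddPow (profile p (‖z.1‖ / ρ) - profile p (‖z.2‖ / ρ)) (p - 1) *
      (ψ z.1 - ψ z.2) / ‖z.1 - z.2‖ ^ ((N : ℝ) + p * s) =
      (∫ z in S, G z * ψ z.1) - ∫ z in S, G z * ψ z.2 := by
    rw [← integral_sub hi1 hi2]
    refine setIntegral_congr_fun hSm fun z hz => ?_
    simp only [hG]
    rw [oddPow_of_nonneg hp1 (hinc z hz)]
    ring
  rw [hF, integral_eq_lintegral_of_nonneg_ae (hn Prod.fst) (by fun_prop),
    integral_eq_lintegral_of_nonneg_ae (hn Prod.snd) (by fun_prop), sub_le_iff_le_add']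
  have h0 : 0 ≤ C * ρ ^ (-(p * s)) * ∫ x, ψ x :=
    mul_nonneg (by positivity) (integral_nonneg hψ0)
  rw [← ENNReal.toReal_ofReal h0, ← ENNReal.toReal_add hbfin.ne ENNReal.ofReal_ne_top]
  exact ENNReal.toReal_mono (ENNReal.add_lt_top.2 ⟨hbfin, ENNReal.ofReal_lt_top⟩).ne ha

/-- The barrier is a weak subsolution up to a bounded right-hand side. -/
lemma weakForm_profile_le {N : ℕ} (hN : 1 ≤ N) {s p : ℝ} (hs0 : 0 < s) (hs1 : s < 1)
    (hp : 1 < p) :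
    ∃ C : ℝ, 0 < C ∧ ∀ (ρ : ℝ) (ψ : Space N → ℝ), 0 < ρ → Measurable ψ →
      (∀ x, 0 ≤ ψ x) → (∀ x, ρ ≤ ‖x‖ → ψ x = 0) → Integrable ψ →
      Integrable (fun z : Space N × Space N =>
        oddPow (profile p (‖z.1‖ / ρ) - profile p (‖z.2‖ / ρ)) (p - 1) * (ψ z.1 - ψ z.2) /
          ‖z.1 - z.2‖ ^ ((N : ℝ) + p * s)) →
      weakForm s p (fun x => profile p (‖x‖ / ρ)) ψ ≤ C * ρ ^ (-(p * s)) * ∫ x, ψ x := by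
  obtain ⟨C, hC, H⟩ := setIntegral_profile_le hN hs0 hs1 hp
  refine ⟨2 * C, by positivity, fun ρ ψ hρ hψm hψ0 hψρ hψi hFi => ?_⟩
  unfold weakForm
  set F : Space N × Space N → ℝ := fun z =>
    oddPow (profile p (‖z.1‖ / ρ) - profile p (‖z.2‖ / ρ)) (p - 1) * (ψ z.1 - ψ z.2) /
      ‖z.1 - z.2‖ ^ ((N : ℝ) + p * s) with hF
  have hswap : ∀ z : Space N × Space N, F z.swap = F z := fun z => by
    simp only [hF, Prod.fst_swap, Prod.snd_swap]
    rw [norm_sub_rev, ← neg_sub, oddPow_neg]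
    ring
  -- The cut regions increase to `‖z.1‖ < ‖z.2‖`. The bound on each is independent of the cut, so
  -- integrability of the full form lets it pass to the limit.
  set S : ℕ → Set (Space N × Space N) :=
    fun n => {z | (1 + ((n : ℝ) + 1)⁻¹) * ‖z.1‖ < ‖z.2‖} with hS
  set T : Set (Space N × Space N) := {z | ‖z.1‖ < ‖z.2‖} with hT
  have hTm : MeasurableSet T := measurableSet_lt (by fun_prop) (by fun_prop)
  have hST : ⋃ n, S n = T := by
    ext z
    simp only [hS, hT, mem_iUnion, mem_ofPred_eq]
    constructor
    · rintro ⟨n, hn⟩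
      have : (0 : ℝ) < ((n : ℝ) + 1)⁻¹ := by positivity
      nlinarith [norm_nonneg z.1]
    · intro h
      have : Filter.Tendsto (fun n : ℕ => (1 + ((n : ℝ) + 1)⁻¹) * ‖z.1‖) Filter.atTop
          (nhds ((1 + 0) * ‖z.1‖)) := by
        refine Filter.Tendsto.mul_const _ (tendsto_const_nhds.add ?_)
        simpa using tendsto_one_div_add_atTop_nhds_zero_nat (𝕜 := ℝ)
      rw [add_zero, one_mul] at this
      exact (this.eventually_lt_const h).exists
  have hlim := tendsto_setIntegral_of_monotone (μ := volume) (f := F) (s := S)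
    (fun n => measurableSet_lt (by fun_prop) (by fun_prop))
    (fun m n hmn z (hz : (1 + ((m : ℝ) + 1)⁻¹) * ‖z.1‖ < ‖z.2‖) => by
      have : (1 + ((n : ℝ) + 1)⁻¹) * ‖z.1‖ ≤ (1 + ((m : ℝ) + 1)⁻¹) * ‖z.1‖ := by gcongr
      exact this.trans_lt hz) hFi.integrableOn
  rw [hST] at hlim
  have hle : ∫ z in T, F z ≤ C * ρ ^ (-(p * s)) * ∫ x, ψ x :=
    le_of_tendsto' hlim fun n => H ρ _ ψ hρ (by simp; positivity) hψm hψ0 hψρ hψi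
  -- On `‖z.1‖ = ‖z.2‖` the radial barrier has no increment, so only the two symmetric halves
  -- contribute.
  have hdec : F = fun z => T.indicator F z + T.indicator F z.swap := by
    funext z
    rcases lt_trichotomy ‖z.1‖ ‖z.2‖ with h | h | h
    · rw [indicator_of_mem (by exact h), indicator_of_notMem (by simp [hT, h.le]), add_zero]
    · rw [indicator_of_notMem (by simp [hT, h]), indicator_of_notMem (by simp [hT, h])]
      simp [hF, h, oddPow]
    · rw [indicator_of_notMem (by simp [hT, h.le]), indicator_of_mem (by exact h), zero_add, hswap]
  have hTi : Integrable (T.indicator F) := hFi.indicator hTm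
  have hTs := integrable_comp_swap hTi
  rw [hdec, integral_add hTi hTs, Measure.volume_eq_prod, integral_prod_swap,
    ← Measure.volume_eq_prod, integral_indicator hTm]
  linarith

/-! ### Finite energy of the barrier. -/

/-- A convolution integrand of two `L¹` functions. With its swap it dominates energies of pairs that
have at least one point in the ball. -/
lemma integrable_ball_mul_kernel {N : ℕ} (hN : 1 ≤ N) {s p δ : ℝ} (hs0 : 0 < s) (hs1 : s < 1)
    (hp : 1 < p) (hδ : 0 < δ) (ρ : ℝ) :
    Integrable fun z : Space N × Space N => (Metric.ball (0 : Space N) ρ).indicator 1 z.1 *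
      (min 1 ((‖z.1 - z.2‖ / δ) ^ p) / ‖z.1 - z.2‖ ^ ((N : ℝ) + p * s)) := by
  have h1 : Integrable ((Metric.ball (0 : Space N) ρ).indicator (1 : Space N → ℝ)) :=
    (integrable_indicator_iff measurableSet_ball).2
      (integrableOn_const (C := (1 : ℝ)) measure_ball_lt_top.ne)
  have h2 := (h1.convolution_integrand (ContinuousLinearMap.mul ℝ ℝ)
    (integrable_min_one_kernel_scaled hN hs0 hs1 hp hδ)).swap
  rw [Measure.volume_eq_prod]
  refine h2.congr (Filter.Eventually.of_forall fun z => ?_)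
  simp [norm_sub_rev]

lemma integrable_profile_gagliardo {N : ℕ} (hN : 1 ≤ N) {s p ρ : ℝ} (hs0 : 0 < s) (hs1 : s < 1)
    (hp : 1 < p) (hρ : 0 < ρ) :
    Integrable fun z : Space N × Space N =>
      |profile p (‖z.1‖ / ρ) - profile p (‖z.2‖ / ρ)| ^ p / ‖z.1 - z.2‖ ^ ((N : ℝ) + p * s) := by
  have hb := one_lt_dualExp hp
  have h := integrable_ball_mul_kernel hN hs0 hs1 hp hρ ρ
  refine ((h.add (integrable_comp_swap h)).const_mul ((p / (p - 1)) ^ p)).mono'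
    (Measurable.aestronglyMeasurable (by fun_prop))
    (Filter.Eventually.of_forall fun z => ?_)
  rw [Real.norm_of_nonneg (by positivity)]
  simp only [Pi.add_apply, Prod.fst_swap, Prod.snd_swap, norm_sub_rev z.2 z.1]
  rw [← add_mul, mul_left_comm, ← mul_div_assoc, ← mul_div_assoc]
  gcongr
  have h0 : ∀ x : Space N, 0 ≤ (Metric.ball (0 : Space N) ρ).indicator (1 : Space N → ℝ) x :=
    fun x => indicator_nonneg (fun _ _ => zero_le_one) x
  have hout : ∀ x : Space N, x ∉ Metric.ball (0 : Space N) ρ → profile p (‖x‖ / ρ) = 0 :=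
    fun x hx => profile_eq_zero ((one_le_div hρ).2 (by simpa using hx))
  -- The profile takes values in `[0, 1]` and is Lipschitz with constant `p / (p - 1) ≥ 1`; these
  -- give the two entries of the minimum.
  have hle : |profile p (‖z.1‖ / ρ) - profile p (‖z.2‖ / ρ)| ^ p ≤
      (p / (p - 1)) ^ p * min 1 ((‖z.1 - z.2‖ / ρ) ^ p) := by
    rw [mul_min_of_nonneg _ _ (by positivity), mul_one, ← Real.mul_rpow (by positivity)
      (by positivity)]
    refine le_min ?_ ?_
    · gcongr
      have h1 := profile_nonneg hp (t := ‖z.1‖ / ρ) (by positivity)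
      have h2 := profile_nonneg hp (t := ‖z.2‖ / ρ) (by positivity)
      have h3 := profile_le_one (p := p) (t := ‖z.1‖ / ρ) (by positivity)
      have h4 := profile_le_one (p := p) (t := ‖z.2‖ / ρ) (by positivity)
      rw [abs_le]; constructor <;> linarith
    · gcongr
      refine (abs_profile_sub_le hp (by positivity) (by positivity)).trans ?_
      gcongr
      rw [← sub_div, abs_div, abs_of_pos hρ]
      gcongr
      exact abs_norm_sub_norm_le _ _
  have hm : 0 ≤ (p / (p - 1)) ^ p * min 1 ((‖z.1 - z.2‖ / ρ) ^ p) := by positivity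
  by_cases h1 : z.1 ∈ Metric.ball (0 : Space N) ρ
  · rw [indicator_of_mem h1, Pi.one_apply]
    nlinarith [h0 z.2]
  by_cases h2 : z.2 ∈ Metric.ball (0 : Space N) ρ
  · rw [indicator_of_mem h2, Pi.one_apply]
    nlinarith [h0 z.1]
  rw [hout _ h1, hout _ h2, sub_zero, abs_zero, Real.zero_rpow (by linarith)]
  exact mul_nonneg (add_nonneg (h0 _) (h0 _)) hm

/-! ### The excess: admissibility as a test function and convergence of the forms. -/

/-- The part of the barrier `m φ(· / ρ)` above `u`. -/
noncomputable def excess {N : ℕ} (p ρ m : ℝ) (u : Space N → ℝ) (x : Space N) : ℝ :=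
  max (m * profile p (‖x‖ / ρ) - u x) 0

section excess

variable {N : ℕ} {p ρ m : ℝ} {u : Space N → ℝ}

lemma measurable_excess (hu : Measurable u) : Measurable (excess p ρ m u) := by
  unfold excess; fun_prop

lemma excess_nonneg (x : Space N) : 0 ≤ excess p ρ m u x := le_max_right _ _

lemma excess_le (hρ : 0 < ρ) (hm : 0 ≤ m) (hu : ∀ x, 0 ≤ u x) (x : Space N) :
    excess p ρ m u x ≤ m := by
  refine max_le ?_ hm
  have := mul_le_mul_of_nonneg_left (profile_le_one (p := p) (t := ‖x‖ / ρ) (by positivity)) hm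
  linarith [hu x]

lemma excess_eq_zero (hρ : 0 < ρ) (hu : ∀ x, 0 ≤ u x) {x : Space N}
    (hx : x ∉ Metric.ball (0 : Space N) ρ) : excess p ρ m u x = 0 := by
  have h : profile p (‖x‖ / ρ) = 0 := profile_eq_zero ((one_le_div hρ).2 (by simpa using hx))
  simp [excess, h, hu x]

lemma abs_excess_sub_le (hm : 0 ≤ m) (x y : Space N) :
    |excess p ρ m u x - excess p ρ m u y| ≤
      m * |profile p (‖x‖ / ρ) - profile p (‖y‖ / ρ)| + |u x - u y| := by
  refine (abs_max_sub_max_le_abs _ _ _).trans ?_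
  rw [sub_sub_sub_comm, ← mul_sub]
  refine (abs_sub _ _).trans_eq ?_
  rw [abs_mul, abs_of_nonneg hm]

lemma memLp_excess (hρ : 0 < ρ) (hm : 0 ≤ m) (hum : Measurable u) (hu : ∀ x, 0 ≤ u x)
    (q : ENNReal) : MemLp (excess p ρ m u) q := by
  have h : MemLp ((Metric.ball (0 : Space N) ρ).indicator fun _ => m) q :=
    memLp_indicator_const q measurableSet_ball m (Or.inr measure_ball_lt_top.ne)
  refine h.mono (measurable_excess hum).aestronglyMeasurable (Filter.Eventually.of_forall fun x => ?_)
  rw [Real.norm_of_nonneg (excess_nonneg x)]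
  by_cases hx : x ∈ Metric.ball (0 : Space N) ρ
  · rw [indicator_of_mem hx]
    exact (excess_le hρ hm hu x).trans (le_abs_self m)
  · rw [excess_eq_zero hρ hu hx]; positivity

lemma integrable_gagliardo_indicator {s : ℝ} {W : Set (Space N)} (hW : MeasurableSet W)
    (hum : Measurable u) (h : gagliardoPow s p W u < ⊤) :
    Integrable ((W ×ˢ W).indicator fun z : Space N × Space N =>
      |u z.1 - u z.2| ^ p / ‖z.1 - z.2‖ ^ ((N : ℝ) + p * s)) := by
  rw [integrable_indicator_iff (hW.prod hW)]
  refine ⟨Measurable.aestronglyMeasurable (by fun_prop), ?_⟩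
  rw [hasFiniteIntegral_iff_ofReal (Filter.Eventually.of_forall fun z => by positivity)]
  exact h

/-- For pairs inside the larger ball, increments of the excess are controlled by those of the
barrier and of `u`. If one point is in the small ball and the other outside the larger one, they are
at least `δ` apart and boundedness suffices. All other pairs contribute zero. -/
lemma integrable_excess_gagliardo (hN : 1 ≤ N) {s δ : ℝ} (hs0 : 0 < s) (hs1 : s < 1)
    (hp : 1 < p) (hρ : 0 < ρ) (hδ : 0 < δ) (hm : 0 ≤ m) (hum : Measurable u) (hu : ∀ x, 0 ≤ u x)
    (h : gagliardoPow s p (Metric.ball 0 (ρ + δ)) u < ⊤) :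
    Integrable fun z : Space N × Space N =>
      |excess p ρ m u z.1 - excess p ρ m u z.2| ^ p / ‖z.1 - z.2‖ ^ ((N : ℝ) + p * s) := by
  set W := Metric.ball (0 : Space N) (ρ + δ) with hW
  set B := Metric.ball (0 : Space N) ρ with hB
  have hBW : B ⊆ W := Metric.ball_subset_ball (by linarith)
  have hk := integrable_ball_mul_kernel hN hs0 hs1 hp hδ ρ
  have hψm : Measurable (excess p ρ m u) := measurable_excess hum
  refine ((((integrable_profile_gagliardo hN hs0 hs1 hp hρ).const_mul (m ^ p)).add
    (integrable_gagliardo_indicator measurableSet_ball hum h)).const_mul (2 ^ p) |>.add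
    ((hk.add (integrable_comp_swap hk)).const_mul (m ^ p))).mono'
    (Measurable.aestronglyMeasurable (by fun_prop))
    (Filter.Eventually.of_forall fun z => ?_)
  rw [Real.norm_of_nonneg (by positivity)]
  simp only [Pi.add_apply, Prod.fst_swap, Prod.snd_swap, norm_sub_rev z.2 z.1]
  have h0 : ∀ x : Space N, 0 ≤ B.indicator (1 : Space N → ℝ) x :=
    fun x => indicator_nonneg (fun _ _ => zero_le_one) x
  have hU : 0 ≤ (W ×ˢ W).indicator (fun z : Space N × Space N =>
      |u z.1 - u z.2| ^ p / ‖z.1 - z.2‖ ^ ((N : ℝ) + p * s)) z :=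
    indicator_nonneg (fun z _ => by positivity) z
  have hP : 0 ≤ m ^ p * (|profile p (‖z.1‖ / ρ) - profile p (‖z.2‖ / ρ)| ^ p /
      ‖z.1 - z.2‖ ^ ((N : ℝ) + p * s)) := by positivity
  have hK : 0 ≤ min 1 ((‖z.1 - z.2‖ / δ) ^ p) / ‖z.1 - z.2‖ ^ ((N : ℝ) + p * s) := by positivity
  have hK1 := mul_nonneg (h0 z.1) hK
  have hK2 := mul_nonneg (h0 z.2) hK
  have hmp : 0 ≤ m ^ p := by positivity
  have h2p : (0 : ℝ) < 2 ^ p := by positivity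
  have hfar : ∀ x y : Space N, x ∈ B → y ∉ W → δ ≤ ‖x - y‖ := fun x y hx hy => by
    rw [hB, mem_ball_zero_iff] at hx
    rw [hW, mem_ball_zero_iff, not_lt] at hy
    have := norm_sub_norm_le y x
    rw [norm_sub_rev]; linarith
  have hone : δ ≤ ‖z.1 - z.2‖ → min 1 ((‖z.1 - z.2‖ / δ) ^ p) = 1 := fun h =>
    min_eq_left (Real.one_le_rpow ((one_le_div hδ).2 h) (by linarith))
  have habs : |excess p ρ m u z.1 - excess p ρ m u z.2| ≤ m := by
    have h1 := excess_nonneg (p := p) (ρ := ρ) (m := m) (u := u) z.1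
    have h2 := excess_nonneg (p := p) (ρ := ρ) (m := m) (u := u) z.2
    have h3 := excess_le (p := p) hρ hm hu z.1
    have h4 := excess_le (p := p) hρ hm hu z.2
    rw [abs_le]; constructor <;> linarith
  have hfarle : |excess p ρ m u z.1 - excess p ρ m u z.2| ^ p / ‖z.1 - z.2‖ ^ ((N : ℝ) + p * s) ≤
      m ^ p * (1 / ‖z.1 - z.2‖ ^ ((N : ℝ) + p * s)) := by
    rw [mul_one_div]; gcongr
  by_cases hz : z ∈ W ×ˢ W
  · rw [indicator_of_mem hz]
    have hs := abs_excess_sub_le (p := p) (ρ := ρ) (u := u) hm z.1 z.2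
    have : |excess p ρ m u z.1 - excess p ρ m u z.2| ^ p ≤
        2 ^ p * (m ^ p * |profile p (‖z.1‖ / ρ) - profile p (‖z.2‖ / ρ)| ^ p +
          |u z.1 - u z.2| ^ p) := by
      rw [← Real.mul_rpow hm (abs_nonneg _)]
      exact (Real.rpow_le_rpow (abs_nonneg _) hs (by linarith)).trans
        (rpow_add_le_two_rpow_mul (by positivity) (abs_nonneg _) (by linarith))
    have := div_le_div_of_nonneg_right this
      (by positivity : 0 ≤ ‖z.1 - z.2‖ ^ ((N : ℝ) + p * s))
    rw [mul_div_assoc, add_div, mul_div_assoc] at this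
    refine this.trans (le_add_of_nonneg_right ?_)
    exact mul_nonneg hmp (add_nonneg hK1 hK2)
  have hfirst := mul_nonneg h2p.le (add_nonneg hP hU)
  by_cases h1 : z.1 ∈ B
  · have h2 : z.2 ∉ W := fun h => hz ⟨hBW h1, h⟩
    have hd := hfar _ _ h1 h2
    rw [hone hd] at hK2 ⊢
    rw [indicator_of_mem h1, Pi.one_apply, one_mul]
    nlinarith [mul_nonneg hmp hK2]
  by_cases h2 : z.2 ∈ B
  · have h1 : z.1 ∉ W := fun h => hz ⟨h, hBW h2⟩
    have hd := hfar _ _ h2 h1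
    rw [norm_sub_rev] at hd
    rw [hone hd] at hK1 ⊢
    rw [indicator_of_mem h2, Pi.one_apply, one_mul]
    nlinarith [mul_nonneg hmp hK1]
  rw [excess_eq_zero hρ hu h1, excess_eq_zero hρ hu h2, sub_zero, abs_zero,
    Real.zero_rpow (by linarith), zero_div]
  exact add_nonneg hfirst (mul_nonneg hmp (add_nonneg hK1 hK2))

lemma memW0_excess (hN : 1 ≤ N) {s δ : ℝ} (hs0 : 0 < s) (hs1 : s < 1)
    (hp : 1 < p) (hρ : 0 < ρ) (hδ : 0 < δ) (hm : 0 ≤ m) (hum : Measurable u) (hu : ∀ x, 0 ≤ u x)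
    (h : gagliardoPow s p (Metric.ball 0 (ρ + δ)) u < ⊤) :
    MemW0 s p (Metric.ball 0 ρ) (excess p ρ m u) := by
  refine ⟨⟨(memLp_excess hρ hm hum hu _).restrict _, ?_⟩,
    Filter.Eventually.of_forall fun x hx => excess_eq_zero hρ hu hx⟩
  have hi := integrable_excess_gagliardo hN hs0 hs1 hp hρ hδ hm hum hu h
  rw [gagliardoPow, univ_prod_univ, Measure.restrict_univ]
  exact (hasFiniteIntegral_iff_ofReal (Filter.Eventually.of_forall fun z => by positivity)).1 hi.2

lemma integrable_profile_form (hN : 1 ≤ N) {s δ : ℝ} (hs0 : 0 < s) (hs1 : s < 1)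
    (hp : 1 < p) (hρ : 0 < ρ) (hδ : 0 < δ) (hm : 0 ≤ m) (hum : Measurable u) (hu : ∀ x, 0 ≤ u x)
    (h : gagliardoPow s p (Metric.ball 0 (ρ + δ)) u < ⊤) :
    Integrable (fun z : Space N × Space N =>
      oddPow (profile p (‖z.1‖ / ρ) - profile p (‖z.2‖ / ρ)) (p - 1) *
        (excess p ρ m u z.1 - excess p ρ m u z.2) / ‖z.1 - z.2‖ ^ ((N : ℝ) + p * s)) := by
  have hψm : Measurable (excess p ρ m u) := measurable_excess hum
  refine ((integrable_profile_gagliardo hN hs0 hs1 hp hρ).add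
    (integrable_excess_gagliardo hN hs0 hs1 hp hρ hδ hm hum hu h)).mono'
    (Measurable.aestronglyMeasurable (by fun_prop))
    (Filter.Eventually.of_forall fun z => ?_)
  rw [norm_div, Real.norm_of_nonneg (by positivity : 0 ≤ ‖z.1 - z.2‖ ^ ((N : ℝ) + p * s)),
    Pi.add_apply, ← add_div, norm_mul, Real.norm_eq_abs, abs_oddPow (by linarith)]
  gcongr
  exact rpow_sub_one_mul_le (abs_nonneg _) (abs_nonneg _) hp

lemma one_add_norm_le_mul_norm_sub {δ : ℝ} (hρ : 0 < ρ) (hδ : 0 < δ) {x y : Space N}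
    (hx : ‖x‖ < ρ) (hy : ρ + δ ≤ ‖y‖) : 1 + ‖y‖ ≤ (1 + ρ + δ) / δ * ‖x - y‖ := by
  have h := norm_sub_norm_le y x
  rw [norm_sub_rev] at h
  rw [div_mul_eq_mul_div, le_div_iff₀ hδ]
  nlinarith

/-- Inside the larger ball, `a ^ (p - 1) * b ≤ a ^ p + b ^ p` reduces to the two energies. For a far
pair the kernel is comparable to the weight `(1 + ‖y‖) ^ (-(N + ps))`, so local integrability of `u
^ (p - 1)` and its finite tail give the product majorant `T`. -/
lemma integrable_form (hN : 1 ≤ N) {s δ : ℝ} (hs0 : 0 < s) (hs1 : s < 1)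
    (hp : 1 < p) (hρ : 0 < ρ) (hδ : 0 < δ) (hm : 0 ≤ m) (hum : Measurable u) (hu : ∀ x, 0 ≤ u x)
    (h : gagliardoPow s p (Metric.ball 0 (ρ + δ)) u < ⊤)
    (hloc : IntegrableOn (fun x => u x ^ (p - 1)) (Metric.ball 0 ρ))
    (htail : Integrable fun x : Space N => u x ^ (p - 1) / (1 + ‖x‖) ^ ((N : ℝ) + p * s)) :
    Integrable (fun z : Space N × Space N => oddPow (u z.1 - u z.2) (p - 1) *
      (excess p ρ m u z.1 - excess p ρ m u z.2) / ‖z.1 - z.2‖ ^ ((N : ℝ) + p * s)) := by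
  have hp1 : 0 < p - 1 := by linarith
  have hψm : Measurable (excess p ρ m u) := measurable_excess hum
  set W := Metric.ball (0 : Space N) (ρ + δ) with hW
  set B := Metric.ball (0 : Space N) ρ with hB
  have hBW : B ⊆ W := Metric.ball_subset_ball (by linarith)
  set M := (1 + ρ + δ) / δ with hM
  have hM0 : 0 < M := by positivity
  have hw : Integrable fun y : Space N => (1 + ‖y‖) ^ (-((N : ℝ) + p * s)) := by
    refine integrable_one_add_norm ?_
    rw [finrank_euclideanSpace_fin]
    linarith [mul_pos (by linarith : 0 < p) hs0]
  have hB1 : Integrable (B.indicator (1 : Space N → ℝ)) :=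
    (integrable_indicator_iff measurableSet_ball).2
      (integrableOn_const (C := (1 : ℝ)) measure_ball_lt_top.ne)
  have hBu : Integrable (B.indicator fun x => u x ^ (p - 1)) :=
    (integrable_indicator_iff measurableSet_ball).2 hloc
  have hT : Integrable fun z : Space N × Space N =>
      (m * 2 ^ (p - 1) * M ^ ((N : ℝ) + p * s)) *
      ((B.indicator fun x => u x ^ (p - 1)) z.1 * (1 + ‖z.2‖) ^ (-((N : ℝ) + p * s)) +
      B.indicator 1 z.1 * (u z.2 ^ (p - 1) / (1 + ‖z.2‖) ^ ((N : ℝ) + p * s))) := by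
    rw [Measure.volume_eq_prod]
    exact ((hBu.mul_prod hw).add (hB1.mul_prod htail)).const_mul _
  set T : Space N × Space N → ℝ := fun z => (m * 2 ^ (p - 1) * M ^ ((N : ℝ) + p * s)) *
      ((B.indicator fun x => u x ^ (p - 1)) z.1 * (1 + ‖z.2‖) ^ (-((N : ℝ) + p * s)) +
      B.indicator 1 z.1 * (u z.2 ^ (p - 1) / (1 + ‖z.2‖) ^ ((N : ℝ) + p * s))) with hTdef
  have hu1 : ∀ x, 0 ≤ u x ^ (p - 1) := fun x => Real.rpow_nonneg (hu x) _
  have hT0 : ∀ z, 0 ≤ T z := fun z => by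
    have h1 : 0 ≤ B.indicator (fun x => u x ^ (p - 1)) z.1 := indicator_nonneg (fun x _ => hu1 x) _
    have h2 : 0 ≤ B.indicator (1 : Space N → ℝ) z.1 := indicator_nonneg (fun _ _ => zero_le_one) _
    have h3 := hu1 z.2
    simp only [hTdef]
    positivity
  have hfar : ∀ x y : Space N, x ∈ B → y ∉ W →
      |u x - u y| ^ (p - 1) * excess p ρ m u x / ‖x - y‖ ^ ((N : ℝ) + p * s) ≤ T (x, y) := by
    intro x y hx hy
    simp only [hTdef]
    rw [indicator_of_mem hx, indicator_of_mem hx, Pi.one_apply, one_mul,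
      Real.rpow_neg (by positivity), ← div_eq_mul_inv, ← add_div]
    rw [hB, mem_ball_zero_iff] at hx
    rw [hW, mem_ball_zero_iff, not_lt] at hy
    have hd := one_add_norm_le_mul_norm_sub hρ hδ hx hy
    have hxy : 0 < ‖x - y‖ := by
      have : 0 < 1 + ‖y‖ := by positivity
      by_contra hc
      nlinarith
    have h1 : |u x - u y| ^ (p - 1) ≤ 2 ^ (p - 1) * (u x ^ (p - 1) + u y ^ (p - 1)) := by
      refine le_trans (Real.rpow_le_rpow (abs_nonneg _) ?_ hp1.le)
        (rpow_add_le_two_rpow_mul (hu x) (hu y) hp1.le)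
      rw [abs_le]; constructor <;> linarith [hu x, hu y]
    have h2 : (1 + ‖y‖) ^ ((N : ℝ) + p * s) ≤
        M ^ ((N : ℝ) + p * s) * ‖x - y‖ ^ ((N : ℝ) + p * s) := by
      rw [← Real.mul_rpow hM0.le hxy.le]
      gcongr
    have h3 := excess_le (p := p) hρ hm hu x
    have h3' := excess_nonneg (p := p) (ρ := ρ) (m := m) (u := u) x
    have hs : 0 ≤ u x ^ (p - 1) + u y ^ (p - 1) := add_nonneg (hu1 x) (hu1 y)
    rw [div_le_iff₀ (by positivity), mul_div_assoc', div_mul_eq_mul_div, le_div_iff₀ (by positivity)]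
    calc _ ≤ 2 ^ (p - 1) * (u x ^ (p - 1) + u y ^ (p - 1)) * m *
          (M ^ ((N : ℝ) + p * s) * ‖x - y‖ ^ ((N : ℝ) + p * s)) := by gcongr
      _ = _ := by ring
  refine (((integrable_gagliardo_indicator measurableSet_ball hum h).add
    (integrable_excess_gagliardo hN hs0 hs1 hp hρ hδ hm hum hu h)).add
    (hT.add (integrable_comp_swap hT))).mono'
    (Measurable.aestronglyMeasurable (by fun_prop))
    (Filter.Eventually.of_forall fun z => ?_)
  rw [norm_div, Real.norm_of_nonneg (by positivity : 0 ≤ ‖z.1 - z.2‖ ^ ((N : ℝ) + p * s)),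
    norm_mul, Real.norm_eq_abs, abs_oddPow hp1, Real.norm_eq_abs]
  simp only [Pi.add_apply]
  have hU : 0 ≤ (W ×ˢ W).indicator (fun z : Space N × Space N =>
      |u z.1 - u z.2| ^ p / ‖z.1 - z.2‖ ^ ((N : ℝ) + p * s)) z :=
    indicator_nonneg (fun z _ => by positivity) z
  have hE : 0 ≤ |excess p ρ m u z.1 - excess p ρ m u z.2| ^ p /
    ‖z.1 - z.2‖ ^ ((N : ℝ) + p * s) := by positivity
  have hTz := hT0 z
  have hTs := hT0 z.swap
  by_cases hz : z ∈ W ×ˢ W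
  · rw [indicator_of_mem hz, ← add_div]
    refine le_trans ?_ (le_add_of_nonneg_right (add_nonneg hTz hTs))
    gcongr
    exact rpow_sub_one_mul_le (abs_nonneg _) (abs_nonneg _) hp
  refine le_trans ?_ (le_add_of_nonneg_left (add_nonneg hU hE))
  by_cases h1 : z.1 ∈ B
  · have h2 : z.2 ∉ W := fun h => hz ⟨hBW h1, h⟩
    have := hfar _ _ h1 h2
    rw [excess_eq_zero hρ hu (fun h => h2 (hBW h)), sub_zero, abs_of_nonneg (excess_nonneg _)]
    exact this.trans (le_add_of_nonneg_right hTs)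
  by_cases h2 : z.2 ∈ B
  · have h3 : z.1 ∉ W := fun h => hz ⟨h, hBW h2⟩
    have := hfar _ _ h2 h3
    rw [excess_eq_zero hρ hu h1, zero_sub, abs_neg, abs_of_nonneg (excess_nonneg _), abs_sub_comm,
      norm_sub_rev]
    exact this.trans (le_add_of_nonneg_left hTz)
  rw [excess_eq_zero hρ hu h1, excess_eq_zero hρ hu h2, sub_zero, abs_zero, mul_zero, zero_div]
  positivity

end excess

/-! ### Change of representative, consequences of the function spaces, annulus volume, essential
infimum. -/

lemma prod_ae_of_ae {N : ℕ} {P : Space N → Prop} (h : ∀ᵐ x : Space N, P x) :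
    ∀ᵐ z : Space N × Space N, P z.1 ∧ P z.2 := by
  rw [Measure.volume_eq_prod]
  exact (Measure.quasiMeasurePreserving_fst.ae h).and (Measure.quasiMeasurePreserving_snd.ae h)

lemma weakForm_congr_ae {N : ℕ} {s p : ℝ} {u v : Space N → ℝ} (h : u =ᵐ[volume] v)
    (φ : Space N → ℝ) : weakForm s p u φ = weakForm s p v φ := by
  refine integral_congr_ae ?_
  filter_upwards [prod_ae_of_ae h] with z hz
  rw [hz.1, hz.2]

lemma MemWTilde.congr_ae {N : ℕ} {s p : ℝ} {U : Set (Space N)} {u v : Space N → ℝ}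
    (hu : MemWTilde s p U u) (h : u =ᵐ[volume] v) : MemWTilde s p U v := by
  obtain ⟨h1, ⟨V, hV, hc, hcV, hW1, hW2⟩, h3⟩ := hu
  refine ⟨fun A hA => (h1 A hA).ae_eq (ae_restrict_of_ae h),
    ⟨V, hV, hc, hcV, hW1.ae_eq (ae_restrict_of_ae h), ?_⟩, ?_⟩
  · refine lt_of_eq_of_lt (lintegral_congr_ae (ae_restrict_of_ae ?_)) hW2
    filter_upwards [prod_ae_of_ae h] with z hz
    rw [hz.1, hz.2]
  · refine lt_of_eq_of_lt (lintegral_congr_ae ?_) h3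
    filter_upwards [h] with x hx
    rw [hx]

lemma WeaklyGE.congr_ae {N : ℕ} {s p c : ℝ} {U : Set (Space N)} {u v : Space N → ℝ}
    (hu : WeaklyGE s p U u c) (h : u =ᵐ[volume] v) : WeaklyGE s p U v c :=
  ⟨hu.1.congr_ae h, fun φ hφ hφ0 => by
    rw [← weakForm_congr_ae h]; exact hu.2 φ hφ hφ0⟩

lemma MemLpLoc.aemeasurable {N : ℕ} {p : ℝ} {u : Space N → ℝ} (h : MemLpLoc p u) :
    AEMeasurable u := by
  rw [← Measure.restrict_univ (μ := volume), ← Metric.iUnion_closedBall_nat (0 : Space N),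
    aemeasurable_iUnion_iff]
  exact fun n => (h _ (isCompact_closedBall 0 n)).aestronglyMeasurable.aemeasurable

lemma MemLpLoc.integrableOn_rpow_sub_one {N : ℕ} {p : ℝ} {u : Space N → ℝ} (hp : 1 < p)
    (hum : Measurable u) (hu : ∀ x, 0 ≤ u x) (h : MemLpLoc p u) (r : ℝ) :
    IntegrableOn (fun x => u x ^ (p - 1)) (Metric.ball 0 r) := by
  have h1 := (h _ (isCompact_closedBall (0 : Space N) r)).integrable_norm_rpow
    (by simp; linarith) ENNReal.ofReal_ne_top
  rw [ENNReal.toReal_ofReal (by linarith)] at h1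
  have h2 : IntegrableOn (fun x => 1 + ‖u x‖ ^ p) (Metric.closedBall 0 r) :=
    (integrableOn_const (C := (1 : ℝ)) measure_closedBall_lt_top.ne).add h1
  refine (h2.mono_set Metric.ball_subset_closedBall).mono'
    (Measurable.aestronglyMeasurable (by fun_prop))
    (Filter.Eventually.of_forall fun x => ?_)
  rw [Real.norm_of_nonneg (Real.rpow_nonneg (hu x) _), Real.norm_of_nonneg (hu x)]
  exact rpow_sub_one_le_one_add_rpow (hu x) hp

lemma MemWTilde.integrable_tail {N : ℕ} {s p : ℝ} {U : Set (Space N)} {u : Space N → ℝ}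
    (hum : Measurable u) (hu : ∀ x, 0 ≤ u x) (h : MemWTilde s p U u) :
    Integrable fun x : Space N => u x ^ (p - 1) / (1 + ‖x‖) ^ ((N : ℝ) + p * s) := by
  refine ⟨Measurable.aestronglyMeasurable (by fun_prop), ?_⟩
  rw [hasFiniteIntegral_iff_ofReal (Filter.Eventually.of_forall fun x =>
    div_nonneg (Real.rpow_nonneg (hu x) _) (by positivity))]
  refine lt_of_eq_of_lt (lintegral_congr fun x => ?_) h.2.2
  rw [abs_of_nonneg (hu x)]

/-- Compactness of the closed ball inside `V` leaves a margin `δ`, which separates the support of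
the excess from the region where only the tail of `u` is controlled. -/
lemma MemWTilde.exists_gagliardoPow_ball_lt_top {N : ℕ} {s p ρ : ℝ} {u : Space N → ℝ} (hρ : 0 < ρ)
    (h : MemWTilde s p (Metric.ball 0 ρ) u) :
    ∃ δ : ℝ, 0 < δ ∧ gagliardoPow s p (Metric.ball 0 (ρ + δ)) u < ⊤ := by
  obtain ⟨-, ⟨V, hV, hc, hcV, -, hW⟩, -⟩ := h
  obtain ⟨δ, hδ, hδV⟩ := hc.exists_thickening_subset_open hV hcV
  refine ⟨δ, hδ, lt_of_le_of_lt (lintegral_mono_set ?_) hW⟩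
  rw [closure_ball _ hρ.ne', thickening_closedBall hδ hρ.le, add_comm] at hδV
  exact prod_mono hδV hδV

lemma volume_real_annulus {N : ℕ} (hN : 1 ≤ N) :
    ∃ κ : ℝ, 0 < κ ∧ ∀ R : ℝ, 0 < R →
      volume.real (Metric.ball (0 : Space N) R \ Metric.ball 0 (R / 2)) = κ * R ^ (N : ℝ) := by
  have hv : 0 < volume.real (Metric.ball (0 : Space N) 1) :=
    ENNReal.toReal_pos (Metric.measure_ball_pos _ _ one_pos).ne' measure_ball_lt_top.ne
  have hlt : (1 / 2 : ℝ) ^ N < 1 := pow_lt_one₀ (by norm_num) (by norm_num) (by omega)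
  refine ⟨volume.real (Metric.ball (0 : Space N) 1) * (1 - (1 / 2) ^ N),
    mul_pos hv (by linarith), fun R hR => ?_⟩
  rw [measureReal_sdiff (Metric.ball_subset_ball (by linarith)) measurableSet_ball,
    measureReal_def, measureReal_def, Measure.addHaar_ball_of_pos _ _ hR,
    Measure.addHaar_ball_of_pos _ _ (by positivity : 0 < R / 2), finrank_euclideanSpace_fin,
    ENNReal.toReal_mul, ENNReal.toReal_mul, ENNReal.toReal_ofReal (by positivity),
    ENNReal.toReal_ofReal (by positivity), ← measureReal_def, Real.rpow_natCast]
  simp only [div_pow, one_pow]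
  field_simp

/-- The real-valued `essInf` is meaningful only if the a.e. lower bounds are bounded above. For `μ ≠
0` this holds because some set `{u ≤ n}` is not null. -/
lemma le_essInf_of_ae_le {X : Type*} [MeasurableSpace X] {μ : Measure X} (hμ : μ ≠ 0)
    {u : X → ℝ} {a : ℝ} (h : ∀ᵐ x ∂μ, a ≤ u x) : a ≤ essInf u μ := by
  refine Filter.le_liminf_of_le ?_ h
  have : ∃ n : ℕ, ∃ᶠ x in ae μ, u x ≤ n := by
    by_contra! hc
    have h1 : ∀ᵐ x ∂μ, ∀ n : ℕ, ¬ u x ≤ n :=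
      ae_all_iff.2 fun n => (hc n).mono fun x h => not_le.2 h
    have h2 : ∀ᵐ x ∂μ, False := by
      filter_upwards [h1] with x hx
      obtain ⟨n, hn⟩ := exists_nat_ge (u x)
      exact hx n hn
    exact hμ (by simpa using h2)
  obtain ⟨n, hn⟩ := this
  exact Filter.IsCoboundedUnder.of_frequently_le hn

/-! ### Comparison of `u` with the barrier. -/

/-- The excess as a test function: pointwise comparison of the form of `u` with the form of the
barrier, with the gain coming from the annulus. -/
lemma form_excess_le {N : ℕ} {s p R m : ℝ} (hs0 : 0 < s) (hp : 1 < p) (hR : 0 < R) (hm : 0 ≤ m)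
    {u : Space N → ℝ} (hu : ∀ x, 0 ≤ u x) (z : Space N × Space N) :
    oddPow (u z.1 - u z.2) (p - 1) * (excess p (R / 3) m u z.1 - excess p (R / 3) m u z.2) /
        ‖z.1 - z.2‖ ^ ((N : ℝ) + p * s) ≤
      m ^ (p - 1) * (oddPow (profile p (‖z.1‖ / (R / 3)) - profile p (‖z.2‖ / (R / 3))) (p - 1) *
        (excess p (R / 3) m u z.1 - excess p (R / 3) m u z.2) /
        ‖z.1 - z.2‖ ^ ((N : ℝ) + p * s)) +
      (excess p (R / 3) m u z.1 * (Metric.ball (0 : Space N) R \ Metric.ball 0 (R / 2)).indicator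
          (fun y => 2 * m ^ (p - 1) * (R / 6) ^ (-((N : ℝ) + p * s)) -
            (u y / 2) ^ (p - 1) * (2 * R) ^ (-((N : ℝ) + p * s))) z.2 +
        excess p (R / 3) m u z.2 * (Metric.ball (0 : Space N) R \ Metric.ball 0 (R / 2)).indicator
          (fun y => 2 * m ^ (p - 1) * (R / 6) ^ (-((N : ℝ) + p * s)) -
            (u y / 2) ^ (p - 1) * (2 * R) ^ (-((N : ℝ) + p * s))) z.1) := by
  have hp1 : 0 < p - 1 := by linarith
  have hρ : 0 < R / 3 := by positivity
  set A := Metric.ball (0 : Space N) R \ Metric.ball 0 (R / 2) with hA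
  set B := Metric.ball (0 : Space N) (R / 3) with hB
  set e : Space N → ℝ := fun y => 2 * m ^ (p - 1) * (R / 6) ^ (-((N : ℝ) + p * s)) -
            (u y / 2) ^ (p - 1) * (2 * R) ^ (-((N : ℝ) + p * s)) with he
  have hAB : ∀ x ∈ A, x ∉ B := fun x hx hx' => hx.2 (Metric.ball_subset_ball (by linarith) hx')
  have hcross : ∀ x y : Space N, x ∈ B → y ∈ A →
      oddPow (u x - u y) (p - 1) * excess p (R / 3) m u x / ‖x - y‖ ^ ((N : ℝ) + p * s) ≤
      m ^ (p - 1) * (oddPow (profile p (‖x‖ / (R / 3)) - profile p (‖y‖ / (R / 3))) (p - 1) *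
        excess p (R / 3) m u x / ‖x - y‖ ^ ((N : ℝ) + p * s)) +
      excess p (R / 3) m u x * e y := by
    intro x y hx hy
    have hE := excess_nonneg (p := p) (ρ := R / 3) (m := m) (u := u) x
    have hy' := hAB y hy
    have hpy : profile p (‖y‖ / (R / 3)) = 0 :=
      profile_eq_zero ((one_le_div hρ).2 (by simpa [hB] using hy'))
    rw [hpy, sub_zero]
    have h1 : 0 ≤ m ^ (p - 1) * (oddPow (profile p (‖x‖ / (R / 3))) (p - 1) *
        excess p (R / 3) m u x / ‖x - y‖ ^ ((N : ℝ) + p * s)) := by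
      have := oddPow_nonneg (q := p - 1) (profile_nonneg hp (t := ‖x‖ / (R / 3)) (by positivity))
      positivity
    refine le_trans ?_ (le_add_of_nonneg_left h1)
    rcases hE.eq_or_lt with h0 | h0
    · simp [← h0]
    rw [mul_comm, mul_div_assoc]
    refine mul_le_mul_of_nonneg_left ?_ hE
    -- A positive excess at `x` forces `u x` below the barrier, hence below `m`.
    have hum : u x ≤ m := by
      by_contra hc
      have h2 := mul_le_mul_of_nonneg_left
        (profile_le_one (p := p) (t := ‖x‖ / (R / 3)) (by positivity)) hm
      have : excess p (R / 3) m u x = 0 := max_eq_right (by linarith)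
      linarith
    have h3 : oddPow (u x - u y) (p - 1) ≤ 2 * m ^ (p - 1) - (u y / 2) ^ (p - 1) :=
      (oddPow_mono hp1 (by linarith)).trans (oddPow_sub_le hp1 hm (hu y))
    rw [hB, mem_ball_zero_iff] at hx
    rw [hA, mem_sdiff, mem_ball_zero_iff, mem_ball_zero_iff, not_lt] at hy
    -- `R / 6 = R / 2 - R / 3` is the gap between ball and annulus. The positive term uses this
    -- lower bound on the distance, the negative one the upper bound `2 * R`.
    have hd1 : R / 6 ≤ ‖x - y‖ := by
      have := norm_sub_norm_le y x
      rw [norm_sub_rev]; linarith [hy.2]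
    have hd2 : ‖x - y‖ ≤ 2 * R := by linarith [norm_sub_le x y, hy.1]
    have hd0 : 0 < ‖x - y‖ := by linarith
    have hα : 0 ≤ (N : ℝ) + p * s := by positivity
    have hu2 : 0 ≤ u y / 2 := by linarith [hu y]
    rw [div_eq_mul_inv, ← Real.rpow_neg hd0.le]
    have h4 : ‖x - y‖ ^ (-((N : ℝ) + p * s)) ≤ (R / 6) ^ (-((N : ℝ) + p * s)) :=
      Real.rpow_le_rpow_of_nonpos (by positivity) hd1 (by linarith)
    have h5 : (2 * R) ^ (-((N : ℝ) + p * s)) ≤ ‖x - y‖ ^ (-((N : ℝ) + p * s)) :=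
      Real.rpow_le_rpow_of_nonpos hd0 hd2 (by linarith)
    calc _ ≤ (2 * m ^ (p - 1) - (u y / 2) ^ (p - 1)) * ‖x - y‖ ^ (-((N : ℝ) + p * s)) := by gcongr
      _ = 2 * m ^ (p - 1) * ‖x - y‖ ^ (-((N : ℝ) + p * s)) -
          (u y / 2) ^ (p - 1) * ‖x - y‖ ^ (-((N : ℝ) + p * s)) := by ring
      _ ≤ _ := by simp only [he]; gcongr
  have hplain : oddPow (u z.1 - u z.2) (p - 1) *
      (excess p (R / 3) m u z.1 - excess p (R / 3) m u z.2) / ‖z.1 - z.2‖ ^ ((N : ℝ) + p * s) ≤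
      m ^ (p - 1) * (oddPow (profile p (‖z.1‖ / (R / 3)) - profile p (‖z.2‖ / (R / 3))) (p - 1) *
        (excess p (R / 3) m u z.1 - excess p (R / 3) m u z.2) /
        ‖z.1 - z.2‖ ^ ((N : ℝ) + p * s)) := by
    rw [← mul_div_assoc, ← mul_assoc, ← oddPow_mul hp1 hm,
      mul_sub m (profile p (‖z.1‖ / (R / 3)))]
    exact div_le_div_of_nonneg_right (oddPow_sub_mul_le hp1 (a := u z.1) (b := u z.2)
      (c := m * profile p (‖z.1‖ / (R / 3))) (d := m * profile p (‖z.2‖ / (R / 3))))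
      (by positivity)
  by_cases h1 : z.1 ∈ A
  · have h1B := hAB _ h1
    rw [indicator_of_mem h1, excess_eq_zero hρ hu h1B, zero_mul, zero_add]
    by_cases h2 : z.2 ∈ B
    · have := hcross z.2 z.1 h2 h1
      rw [norm_sub_rev, ← neg_sub, oddPow_neg,
        ← neg_sub (profile p (‖z.1‖ / (R / 3))), oddPow_neg] at this
      simpa using this
    · rw [excess_eq_zero hρ hu h2]
      simp
  rw [indicator_of_notMem h1, mul_zero, add_zero]
  by_cases h2 : z.2 ∈ A
  · have h2B := hAB _ h2
    rw [indicator_of_mem h2, excess_eq_zero hρ hu h2B, sub_zero]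
    by_cases h3 : z.1 ∈ B
    · exact hcross z.1 z.2 h3 h2
    · rw [excess_eq_zero hρ hu h3]
      simp
  rw [indicator_of_notMem h2, mul_zero, add_zero]
  exact hplain

/-- If the barrier of height `m` is not below `u`, then the mean of `u ^ (p - 1)` over the annulus
is controlled by the height and the right-hand side. -/
lemma setAverage_rpow_le_of_excess {N : ℕ} (hN : 1 ≤ N) {s p : ℝ} (hs0 : 0 < s) (hs1 : s < 1)
    (hp : 1 < p) :
    ∃ c D : ℝ, 0 < c ∧ 0 < D ∧ ∀ (R K m : ℝ) (u : Space N → ℝ), 0 < R → 0 ≤ m →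
      Measurable u → (∀ x, 0 ≤ u x) → WeaklyGE s p (Metric.ball 0 (R / 3)) u (-K) →
      0 < ∫ x, excess p (R / 3) m u x →
      c * (⨍ x in Metric.ball (0 : Space N) R \ Metric.ball 0 (R / 2), u x ^ (p - 1)) ≤
        K * R ^ (p * s) + D * m ^ (p - 1) := by
  obtain ⟨C, hC, H⟩ := weakForm_profile_le hN hs0 hs1 hp
  obtain ⟨κ, hκ, hvol⟩ := volume_real_annulus hN
  have hp1 : 0 < p - 1 := by linarith
  -- The factor 2 counts both orders of a ball-annulus pair, and `κ` turns the integral over the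
  -- annulus into a mean. In the second constant, `C` comes from the barrier and the rest from the
  -- `2 * m ^ (p - 1)` term.
  refine ⟨2 * κ * (1 / 2) ^ (p - 1) * 2 ^ (-((N : ℝ) + p * s)),
    C * (1 / 3) ^ (-(p * s)) + 4 * κ * (1 / 6) ^ (-((N : ℝ) + p * s)), by positivity, by positivity,
    fun R K m u hR hm hum hu hG hpos => ?_⟩
  have hρ : 0 < R / 3 := by positivity
  obtain ⟨δ, hδ, hgag⟩ := hG.1.exists_gagliardoPow_ball_lt_top hρ
  have hloc := hG.1.1.integrableOn_rpow_sub_one hp hum hu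
  have htail := hG.1.integrable_tail hum hu
  set A := Metric.ball (0 : Space N) R \ Metric.ball 0 (R / 2) with hA
  have hAm : MeasurableSet A := measurableSet_ball.diff measurableSet_ball
  have hAfin : volume A ≠ ⊤ := ((measure_mono sdiff_subset).trans_lt measure_ball_lt_top).ne
  set ψ := excess p (R / 3) m u with hψ
  have hψi : Integrable ψ := memLp_one_iff_integrable.1 (memLp_excess hρ hm hum hu 1)
  have htest := hG.2 ψ (memW0_excess hN hs0 hs1 hp hρ hδ hm hum hu hgag)
    (Filter.Eventually.of_forall fun x => excess_nonneg x)
  have hFφ := integrable_profile_form hN hs0 hs1 hp hρ hδ hm hum hu hgag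
  have hFu := integrable_form hN hs0 hs1 hp hρ hδ hm hum hu hgag (hloc _) htail
  have hbar := H (R / 3) ψ hρ (measurable_excess hum) excess_nonneg
    (fun x hx => excess_eq_zero hρ hu (by simpa using hx)) hψi hFφ
  have hAi : IntegrableOn (fun x => u x ^ (p - 1)) A := (hloc R).mono_set sdiff_subset
  set a := 2 * m ^ (p - 1) * (R / 6) ^ (-((N : ℝ) + p * s)) with ha
  set b := (1 / 2) ^ (p - 1) * (2 * R) ^ (-((N : ℝ) + p * s)) with hb
  have e : (fun y => a - (u y / 2) ^ (p - 1) * (2 * R) ^ (-((N : ℝ) + p * s))) =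
      fun y => a - b * u y ^ (p - 1) := by
    funext y
    rw [Real.div_rpow (hu y) zero_le_two, hb, Real.div_rpow zero_le_one zero_le_two,
      Real.one_rpow]
    ring
  have hei : IntegrableOn (fun y => a - (u y / 2) ^ (p - 1) * (2 * R) ^ (-((N : ℝ) + p * s))) A := by
    rw [e]
    exact (integrableOn_const hAfin).sub (hAi.const_mul b)
  have heint : ∫ y in A, (a - (u y / 2) ^ (p - 1) * (2 * R) ^ (-((N : ℝ) + p * s))) =
      a * volume.real A - b * ∫ y in A, u y ^ (p - 1) := by
    have hca : Integrable (fun _ : Space N => a) (volume.restrict A) := integrableOn_const hAfin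
    rw [e, integral_sub hca (hAi.const_mul b), integral_const_mul b,
      setIntegral_const, smul_eq_mul, mul_comm a]
  have hEi : Integrable fun z : Space N × Space N => ψ z.1 * A.indicator
      (fun y => a - (u y / 2) ^ (p - 1) * (2 * R) ^ (-((N : ℝ) + p * s))) z.2 := by
    rw [Measure.volume_eq_prod]
    exact hψi.mul_prod ((integrable_indicator_iff hAm).2 hei)
  have hEint : ∫ z : Space N × Space N, ψ z.1 * A.indicator
      (fun y => a - (u y / 2) ^ (p - 1) * (2 * R) ^ (-((N : ℝ) + p * s))) z.2 =
      (∫ x, ψ x) * (a * volume.real A - b * ∫ y in A, u y ^ (p - 1)) := by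
    rw [Measure.volume_eq_prod, integral_prod_mul, integral_indicator hAm, heint]
  have hEs := integrable_comp_swap hEi
  have hmain : weakForm s p u ψ ≤ m ^ (p - 1) * weakForm s p (fun x => profile p (‖x‖ / (R / 3))) ψ
      + 2 * ((∫ x, ψ x) * (a * volume.real A - b * ∫ y in A, u y ^ (p - 1))) := by
    have h1 := integral_mono hFu ((hFφ.const_mul (m ^ (p - 1))).add (hEi.add hEs))
      (fun z => form_excess_le hs0 hp hR hm hu z)
    refine h1.trans_eq ?_
    have hsw : ∫ z : Space N × Space N, ψ z.swap.1 * A.indicator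
        (fun y => a - (u y / 2) ^ (p - 1) * (2 * R) ^ (-((N : ℝ) + p * s))) z.swap.2 =
        ∫ z : Space N × Space N, ψ z.1 * A.indicator
        (fun y => a - (u y / 2) ^ (p - 1) * (2 * R) ^ (-((N : ℝ) + p * s))) z.2 := by
      rw [Measure.volume_eq_prod]
      exact integral_prod_swap fun z : Space N × Space N => ψ z.1 * A.indicator
        (fun y => a - (u y / 2) ^ (p - 1) * (2 * R) ^ (-((N : ℝ) + p * s))) z.2
    rw [integral_add' (hFφ.const_mul _) (hEi.add hEs), integral_add' hEi hEs, integral_const_mul,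
      hsw, hEint, weakForm]
    ring
  have hBint : ∫ x in Metric.ball 0 (R / 3), -K * ψ x = -K * ∫ x, ψ x := by
    rw [integral_const_mul, setIntegral_eq_integral_of_forall_compl_eq_zero
      fun x hx => excess_eq_zero hρ hu hx]
  rw [hBint] at htest
  have hmp : 0 ≤ m ^ (p - 1) := by positivity
  have h2 := mul_le_mul_of_nonneg_left hbar hmp
  -- Every term carries the factor `∫ ψ`, which is positive and can be divided out.
  have h3 : 0 ≤ (∫ x, ψ x) * (K + m ^ (p - 1) * (C * (R / 3) ^ (-(p * s))) +
      2 * (a * volume.real A - b * ∫ y in A, u y ^ (p - 1))) := by linarith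
  have h4 := nonneg_of_mul_nonneg_right h3 hpos
  rw [setAverage_eq, smul_eq_mul]
  have hvA := hvol R hR
  rw [← hA] at hvA
  have hRN : 0 < R ^ (N : ℝ) := by positivity
  have hRps : 0 < R ^ (p * s) := by positivity
  have eR : R ^ (-((N : ℝ) + p * s)) = (R ^ (N : ℝ))⁻¹ * (R ^ (p * s))⁻¹ := by
    rw [neg_add, Real.rpow_add hR, Real.rpow_neg hR.le, Real.rpow_neg hR.le]
  have e1 : (R / 3) ^ (-(p * s)) = (1 / 3) ^ (-(p * s)) * (R ^ (p * s))⁻¹ := by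
    rw [← Real.rpow_neg hR.le, ← Real.mul_rpow (by norm_num) hR.le]; congr 1; ring
  have e2 : (R / 6) ^ (-((N : ℝ) + p * s)) =
      (1 / 6) ^ (-((N : ℝ) + p * s)) * ((R ^ (N : ℝ))⁻¹ * (R ^ (p * s))⁻¹) := by
    rw [← eR, ← Real.mul_rpow (by norm_num) hR.le]; congr 1; ring
  have e3 : (2 * R) ^ (-((N : ℝ) + p * s)) =
      2 ^ (-((N : ℝ) + p * s)) * ((R ^ (N : ℝ))⁻¹ * (R ^ (p * s))⁻¹) := by
    rw [← eR, ← Real.mul_rpow (by norm_num) hR.le]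
  rw [ha, hb, e1, e2, e3, hvA] at h4
  rw [hvA]
  have h5 := mul_nonneg hRps.le h4
  have h6 : R ^ (p * s) * (K + m ^ (p - 1) * (C * ((1 / 3) ^ (-(p * s)) * (R ^ (p * s))⁻¹)) +
      2 * (2 * m ^ (p - 1) * ((1 / 6) ^ (-((N : ℝ) + p * s)) * ((R ^ (N : ℝ))⁻¹ *
        (R ^ (p * s))⁻¹)) * (κ * R ^ (N : ℝ)) -
        (1 / 2) ^ (p - 1) * (2 ^ (-((N : ℝ) + p * s)) * ((R ^ (N : ℝ))⁻¹ * (R ^ (p * s))⁻¹)) *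
          ∫ y in A, u y ^ (p - 1))) =
      K * R ^ (p * s) + (C * (1 / 3) ^ (-(p * s)) + 4 * κ * (1 / 6) ^ (-((N : ℝ) + p * s))) *
        m ^ (p - 1) - 2 * κ * (1 / 2) ^ (p - 1) * 2 ^ (-((N : ℝ) + p * s)) *
        ((κ * R ^ (N : ℝ))⁻¹ * ∫ y in A, u y ^ (p - 1)) := by
    field_simp
    ring
  rw [h6] at h5
  linarith

end FracPLap

/-! ### Choice of the height and conclusion. -/

open FracPLap in
theorem theorem3p1 (N : ℕ) (hN : 2 ≤ N) (s p : ℝ) (hs0 : 0 < s) (hs1 : s < 1) (hp : 1 < p) :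
    ∃ σ C : ℝ, 0 < σ ∧ σ < 1 ∧ 0 < C ∧
      ∀ (R K : ℝ), 0 < R → 0 ≤ K →
      ∀ u : FracPLap.Space N → ℝ,
        FracPLap.WeaklyGE s p (Metric.ball 0 (R / 3)) u (-K) →
        (∀ᵐ x ∂(volume : Measure (FracPLap.Space N)), 0 ≤ u x) →
        σ * (⨍ x in Metric.ball (0 : FracPLap.Space N) R \ Metric.ball 0 (R / 2),
              u x ^ (p - 1)) ^ (1 / (p - 1))
            - C * (K * R ^ (p * s)) ^ (1 / (p - 1))
          ≤ essInf u (volume.restrict (Metric.ball (0 : FracPLap.Space N) (R / 4))) := by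
  obtain ⟨c, D, hc, hD, H⟩ := setAverage_rpow_le_of_excess (N := N) (by omega) hs0 hs1 hp
  have hp1 : 0 < p - 1 := by linarith
  have hinv : 0 ≤ 1 / (p - 1) := by positivity
  have hexp : 1 / (p - 1) * (p - 1) = 1 := by field_simp
  -- The 4 compensates for the barrier being only at least `m / 4` on `B_{R/4}`. The second entry
  -- makes the `m ^ (p - 1)` term absorbable by half of the mean; the first keeps `σ < 1`.
  set σ := min (1 / 2) ((c / (2 * D)) ^ (1 / (p - 1)) / 4) with hσ
  have hσ0 : 0 < σ := lt_min (by norm_num) (by positivity)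
  have hσ1 : σ ≤ 1 / 2 := min_le_left _ _
  have hσD : D * (4 * σ) ^ (p - 1) ≤ c / 2 := by
    have h1 : 4 * σ ≤ (c / (2 * D)) ^ (1 / (p - 1)) := by
      have := min_le_right (1 / 2) ((c / (2 * D)) ^ (1 / (p - 1)) / 4)
      linarith
    have h2 := Real.rpow_le_rpow (by positivity) h1 hp1.le
    rw [← Real.rpow_mul (by positivity), hexp, Real.rpow_one] at h2
    calc _ ≤ D * (c / (2 * D)) := by gcongr
      _ = c / 2 := by field_simp
  refine ⟨σ, (2 / c) ^ (1 / (p - 1)), hσ0, by linarith, by positivity, ?_⟩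
  intro R K hR hK u hG hu0
  obtain ⟨v, hvm, huv⟩ : ∃ v, Measurable v ∧ u =ᵐ[volume] v := hG.1.1.aemeasurable
  -- Hypotheses and conclusion do not see null sets, so `u` may be replaced by the positive part of
  -- a measurable representative.
  wlog hu : Measurable u ∧ ∀ x, 0 ≤ u x generalizing u
  · have huw : u =ᵐ[volume] fun x => max (v x) 0 := by
      filter_upwards [huv, hu0] with x h1 h2
      rw [← h1, max_eq_left h2]
    have hw0 : ∀ x, 0 ≤ max (v x) 0 := fun x => le_max_right _ _
    have hwm : Measurable fun x => max (v x) 0 := by fun_prop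
    have h := this _ (hG.congr_ae huw) (Filter.Eventually.of_forall hw0)
      (huw.symm.trans huv) ⟨hwm, hw0⟩
    rw [essInf_congr_ae (ae_restrict_of_ae huw), setAverage_eq, integral_congr_ae
      (g := fun x => max (v x) 0 ^ (p - 1)) (by
        filter_upwards [ae_restrict_of_ae huw] with x hx
        rw [hx]), ← setAverage_eq]
    exact h
  obtain ⟨hum, hu⟩ := hu
  set I := ⨍ x in Metric.ball (0 : Space N) R \ Metric.ball 0 (R / 2), u x ^ (p - 1) with hI
  have hI0 : 0 ≤ I := integral_nonneg fun x => Real.rpow_nonneg (hu x) _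
  have hball : volume.restrict (Metric.ball (0 : Space N) (R / 4)) ≠ 0 := by
    rw [Ne, Measure.restrict_eq_zero]
    exact (Metric.measure_ball_pos _ _ (by positivity)).ne'
  have hKR : 0 ≤ K * R ^ (p * s) := by positivity
  set m := 4 * (σ * I ^ (1 / (p - 1))) with hm
  have hm0 : 0 ≤ m := by positivity
  have hψ0 : 0 ≤ excess p (R / 3) m u := excess_nonneg
  refine le_essInf_of_ae_le hball ?_
  rcases (integral_nonneg hψ0).eq_or_lt with h0 | hpos
  · have hψi : Integrable (excess p (R / 3) m u) :=
      memLp_one_iff_integrable.1 (memLp_excess (by positivity) hm0 hum hu 1)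
    have hz := (integral_eq_zero_iff_of_nonneg hψ0 hψi).1 h0.symm
    rw [ae_restrict_iff' measurableSet_ball]
    filter_upwards [hz] with x hx hxB
    rw [mem_ball_zero_iff] at hxB
    have h1 : m * profile p (‖x‖ / (R / 3)) - u x ≤ 0 := by
      have := le_max_left (m * profile p (‖x‖ / (R / 3)) - u x) 0
      exact this.trans_eq hx
    have h2 : 1 / 4 ≤ profile p (‖x‖ / (R / 3)) :=
      quarter_le_profile hp (by positivity) (by rw [div_le_iff₀ (by positivity)]; linarith)
    have h3 := mul_le_mul_of_nonneg_left h2 hm0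
    have h4 : 0 ≤ (2 / c) ^ (1 / (p - 1)) * (K * R ^ (p * s)) ^ (1 / (p - 1)) := by positivity
    linarith
  -- Here the mean is at most `2 / c * (K * R ^ (p * s))`, so the left side is nonpositive and `u ≥
  -- 0` suffices.
  · have h1 := H R K m u hR hm0 hum hu hG hpos
    have hmp : m ^ (p - 1) = (4 * σ) ^ (p - 1) * I := by
      rw [hm, ← mul_assoc, Real.mul_rpow (by positivity) (by positivity), ← Real.rpow_mul hI0, hexp,
        Real.rpow_one]
    rw [← hI, hmp, ← mul_assoc] at h1
    have h2 := mul_le_mul_of_nonneg_right hσD hI0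
    have h3 : I ≤ 2 / c * (K * R ^ (p * s)) := by
      rw [div_mul_eq_mul_div, le_div_iff₀ hc]; linarith
    have h4 := Real.rpow_le_rpow hI0 h3 hinv
    rw [Real.mul_rpow (by positivity) hKR] at h4
    have h5 : σ * I ^ (1 / (p - 1)) ≤ I ^ (1 / (p - 1)) :=
      mul_le_of_le_one_left (by positivity) (by linarith)
    exact Filter.Eventually.of_forall fun x => by linarith [hu x]
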